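/- **Setting.** Let $X$ be a connected 2-complex, i.e. a connected compact Hausdorff space in which every point $x$ has a closed neighbourhood homeomorphic, with $x$ going to the cone point, to the cone $C(\Gamma_x)$ over a finite graph $\Gamma_x$. The point $x$ is generic if $\Gamma_x$ is a circle, a boundary point if $\Gamma_x$ is a segment, a ridge point if $\Gamma_x$ is homeomorphic to the graph $\theta_n$ (two vertices joined by $n$ edges) with $n\ge 3$, and singular otherwise. $\operatorname{Int}(X)$ is the set of generic points. Near a ridge point $X$ is a union of $n\ge 3$ half-planes (branches) with a common boundary line. An oriented link in $X$ is a finite family of oriented closed curves in the union of $\operatorname{Int}(X)$ and the ridge, whose crossings (with themselves and each other) are finite in number, double, transversal and lie in $\operatorname{Int}(X)$, which pass at every ridge point transversally to the ridge from one branch into a different one, and which are dotted: at each crossing one of the two pairs of opposite adjacent areas is chosen (its two areas carry dots). The mirror image $L^{\rm mir}$ is obtained by choosing the other pair at every crossing; $-L$ is $L$ with all orientations reversed. Two oriented links are isotopic if they are related by a finite sequence of ambient isotopies of $X$, oriented basic moves and their inverses. The basic moves are: the Reidemeister moves $M_1^\pm, M_2, M_3$ in a disc in $\operatorname{Int}(X)$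 (a pair of dots encodes the overpassing strand of a crossing: in the local plane picture, rotating it counterclockwise to the other strand sweeps the dotted areas); $M_4$, pushing a strand across the ridge from one branch into another, creating two ridge points; $M_5^\pm$, pushing a crossing with its dots across the ridge from one branch into another; $M_6$, replacing a strand which crosses the ridge from a branch $A$ into a branch $B$ by one that passes from $A$ into a third branch $C$ and then from $C$ into $B$; $M_7$: for a circle $S\subset\Gamma_x$ with $x$ singular, if the link meets the disc $D=C(S)\subset C(\Gamma_x)\subset X$ along one embedded arc with endpoints on $\partial D$, this arc is replaced by any other embedded arc in $D\setminus\{x\}$ with the same endpoints which is transversal to the ridge. Let $\Pi$ be the set of free homotopy classes of loops in $X$ and $\mathbb Z\Pi$ the free abelian group with basis $\Pi$. For an oriented 2-component link $L$ in $X$ and a crossing $c$ of its two components with each other, let $\operatorname{sign}(c)=+1$ if the dots at $c$ lie in the area between the two outgoing half-branches and in the area between the two incoming half-branches, and $\operatorname{sign}(c)=-1$ otherwise; let $\langle c\rangle\in\Pi$ be the class of the loop obtained by the orientation-preserving smoothing of $L$ at $c$ (up to free homotopy it goes from $c$ once along one component and then once along the other). Set $$\operatorname{LK}(L)=\sum_c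 \operatorname{sign}(c)\,\langle c\rangle\in\mathbb Z\Pi,\qquad \operatorname{lk}(L)=\sum_c\operatorname{sign}(c)\in\mathbb Z,$$ where $c$ runs over all crossings of the two components with each other. **Theorem.** (i) If $L$ and $L'$ are isotopic oriented 2-component links in $X$, then $\operatorname{LK}(L)=\operatorname{LK}(L')$. Moreover, for every oriented 2-component link $L$ in $X$: (ii) the additive map $\mathbb Z\Pi\to\mathbb Z$ carrying each element of $\Pi$ to $1$ carries $\operatorname{LK}(L)$ to $\operatorname{lk}(L)$; (iii) $\operatorname{LK}(L^{\rm mir})=-\operatorname{LK}(L)$; (iv) $\operatorname{LK}(-L)=\overline{\operatorname{LK}(L)}$, where the overline is the involution of $\mathbb Z\Pi$ induced by the inversion of loops. -/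

import Mathlib

open Topology Set

/-! ### Finite graphs, cones, 2-complexes -/

/-- A finite graph: finitely many vertices and edges, every edge having an ordered pair of
endpoints; loops and multiple edges are allowed. -/
structure FiniteGraph where
  V : ℕ
  E : ℕ
  ends : Fin E → Fin V × Fin V

namespace FiniteGraph

/-- The end `0` of an edge is glued to its first endpoint, the end `1` to its second one. -/
inductive Glue (Γ : FiniteGraph) :
    Fin Γ.V ⊕ Fin Γ.E × unitInterval → Fin Γ.V ⊕ Fin Γ.E × unitInterval → Prop
  | src (e : Fin Γ.E) : Glue Γ (Sum.inr (e, 0)) (Sum.inl (Γ.ends e).1)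
  | tgt (e : Fin Γ.E) : Glue Γ (Sum.inr (e, 1)) (Sum.inl (Γ.ends e).2)

/-- The underlying topological space of a finite graph. -/
def Space (Γ : FiniteGraph) : Type := Quot Γ.Glue

instance (Γ : FiniteGraph) : TopologicalSpace Γ.Space :=
  inferInstanceAs (TopologicalSpace (Quot Γ.Glue))

/-- The graph `θ_n`: two vertices joined by `n` edges. -/
def theta (n : ℕ) : FiniteGraph := ⟨2, n, fun _ => (0, 1)⟩

end FiniteGraph

/-- All points `(t, 0)` of the cylinder are identified with the cone point `inl ()`. -/
inductive ConeGlue (T : Type) : Unit ⊕ T × unitInterval → Unit ⊕ T × unitInterval → Prop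
  | base (t : T) : ConeGlue T (Sum.inr (t, 0)) (Sum.inl ())

/-- The cone over a space `T`. -/
def Cone (T : Type) : Type := Quot (ConeGlue T)

instance (T : Type) [TopologicalSpace T] : TopologicalSpace (Cone T) :=
  inferInstanceAs (TopologicalSpace (Quot (ConeGlue T)))

def Cone.apex (T : Type) : Cone T := Quot.mk _ (Sum.inl ())

def Cone.mk {T : Type} (t : T) (r : unitInterval) : Cone T := Quot.mk _ (Sum.inr (t, r))

section TwoComplex

variable {X : Type*} [TopologicalSpace X]

/-- `f` is a homeomorphism of the cone over `Γ` onto a closed neighbourhood of `x`,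
carrying the cone point to `x`. -/
structure IsConeChart (x : X) (Γ : FiniteGraph) (f : Cone Γ.Space → X) : Prop where
  isClosedEmbedding : IsClosedEmbedding f
  apex : f (Cone.apex Γ.Space) = x
  range_mem : range f ∈ 𝓝 x

/-- A 2-complex: a compact Hausdorff space in which every point has a closed cone
neighbourhood over a finite graph. -/
structure IsTwoComplex (X : Type*) [TopologicalSpace X] : Prop where
  compact : CompactSpace X
  hausdorff : T2Space X
  cone : ∀ x : X, ∃ (Γ : FiniteGraph) (f : Cone Γ.Space → X), IsConeChart x Γ f

/-- A generic point; the generic points form the interior of `X`. -/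
def IsInteriorPoint (x : X) : Prop :=
  ∃ (Γ : FiniteGraph) (f : Cone Γ.Space → X),
    IsConeChart x Γ f ∧ Nonempty (Γ.Space ≃ₜ Circle)

def IsBoundaryPoint (x : X) : Prop :=
  ∃ (Γ : FiniteGraph) (f : Cone Γ.Space → X),
    IsConeChart x Γ f ∧ Nonempty (Γ.Space ≃ₜ unitInterval)

def IsRidgePoint (x : X) : Prop :=
  ∃ (Γ : FiniteGraph) (f : Cone Γ.Space → X), IsConeChart x Γ f ∧
    ∃ n : ℕ, 3 ≤ n ∧ Nonempty (Γ.Space ≃ₜ (FiniteGraph.theta n).Space)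

def IsSingularPoint (x : X) : Prop :=
  ¬ IsInteriorPoint x ∧ ¬ IsBoundaryPoint x ∧ ¬ IsRidgePoint x

end TwoComplex

/-- The union of `m` closed half-planes with common boundary line: a point is given by a point
of the star with `m` legs in `ℝ^m`, and by the coordinate along the line. -/
def Book (m : ℕ) : Type :=
  {v : Fin m → ℝ // (∀ i, 0 ≤ v i) ∧ ∀ i j, i ≠ j → v i = 0 ∨ v j = 0} × ℝ

instance (m : ℕ) : TopologicalSpace (Book m) :=
  inferInstanceAs (TopologicalSpace
    ({v : Fin m → ℝ // (∀ i, 0 ≤ v i) ∧ ∀ i j, i ≠ j → v i = 0 ∨ v j = 0} × ℝ))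

/-- The point of the `i`-th half-plane with coordinate `x` along the boundary line and distance
`max h 0` from it. -/
def Book.page {m : ℕ} (i : Fin m) (x h : ℝ) : Book m :=
  (⟨Pi.single i (max h 0), by
    constructor
    · intro k
      by_cases hk : k = i
      · subst hk; simp
      · simp [hk]
    · intro k l hkl
      by_cases hk : k = i
      · right
        have : l ≠ i := fun h => hkl (hk.trans h.symm)
        simp [this]
      · left; simp [hk]⟩, x)

/-- The plane formed by the `i`-th half-plane (as the upper one) and the `j`-th half-plane
(as the lower one); the boundary line is the horizontal axis. -/
noncomputable def Book.twoPages {m : ℕ} (i j : Fin m) (z : ℝ × ℝ) : Book m :=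
  if 0 ≤ z.2 then Book.page i z.1 z.2 else Book.page j z.1 (-z.2)

/-! ### Free homotopy classes of loops -/

/-- Free homotopy of loops `ℝ/ℤ → X`. -/
def freeLoopSetoid (X : Type*) [TopologicalSpace X] : Setoid C(UnitAddCircle, X) :=
  ⟨ContinuousMap.Homotopic, ContinuousMap.Homotopic.equivalence⟩

/-- The set `Π` of free homotopy classes of loops in `X`. -/
def FreeLoopClass (X : Type*) [TopologicalSpace X] : Type _ := Quotient (freeLoopSetoid X)

section FreeLoops

variable {X : Type*} [TopologicalSpace X]

/-- A closed path, as a map of the circle. -/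
noncomputable def Path.circleMap {x : X} (p : Path x x) : C(UnitAddCircle, X) :=
  ⟨AddCircle.liftIco 1 0 p.extend,
    AddCircle.liftIco_zero_continuous (by simp) p.continuous_extend.continuousOn⟩

/-- The free homotopy class of a closed path. -/
noncomputable def FreeLoopClass.ofPath {x : X} (p : Path x x) : FreeLoopClass X :=
  Quotient.mk (freeLoopSetoid X) p.circleMap

/-- The circle reversal `s ↦ -s`. -/
def circleNeg : C(UnitAddCircle, UnitAddCircle) := ⟨fun s => -s, continuous_neg⟩

/-- Inversion of free homotopy classes of loops. -/
def FreeLoopClass.inv (a : FreeLoopClass X) : FreeLoopClass X :=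
  Quotient.map (sa := freeLoopSetoid X) (sb := freeLoopSetoid X)
    (fun γ => γ.comp circleNeg)
    (fun _ _ h => ContinuousMap.Homotopic.comp h (ContinuousMap.Homotopic.refl _)) a

/-- The inversion of free homotopy classes is induced by the inversion `p ↦ p⁻¹` of `π₁`. -/
theorem FreeLoopClass.inv_ofPath {x : X} (p : Path x x) :
    (FreeLoopClass.ofPath p).inv = FreeLoopClass.ofPath p.symm := by
  have h : p.circleMap.comp circleNeg = p.symm.circleMap := by
    ext s
    obtain ⟨t, ht, rfl⟩ : ∃ t ∈ Ico (0 : ℝ) 1, ((t : ℝ) : UnitAddCircle) = s := by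
      have := AddCircle.coe_image_Ico_eq (1 : ℝ) 0
      have hs : s ∈ ((↑) : ℝ → UnitAddCircle) '' Ico 0 (0 + 1) := by
        rw [this]; trivial
      simpa using hs
    have hr : p.symm.circleMap (t : UnitAddCircle) = p.symm.extend t :=
      AddCircle.liftIco_zero_coe_apply (p := (1 : ℝ)) (f := p.symm.extend) ht
    rw [hr]
    change AddCircle.liftIco 1 0 p.extend (-(t : UnitAddCircle)) = _
    rcases eq_or_lt_of_le ht.1 with h0 | h0
    · subst h0
      have : (-((0 : ℝ) : UnitAddCircle)) = ((0 : ℝ) : UnitAddCircle) := by simp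
      rw [this, AddCircle.liftIco_zero_coe_apply (by simp)]
      simp
    · have : (-(t : UnitAddCircle)) = ((1 - t : ℝ) : UnitAddCircle) := by
        rw [AddCircle.coe_sub, AddCircle.coe_period, zero_sub]
      rw [this, AddCircle.liftIco_zero_coe_apply ⟨by linarith [ht.2], by linarith⟩,
        Path.extend_symm_apply]
  exact congrArg (Quotient.mk (freeLoopSetoid X)) h

/-- The loop `γ` regarded as a path which starts and ends at `γ s`. -/
def loopFrom (γ : C(UnitAddCircle, X)) (s : UnitAddCircle) : Path (γ s) (γ s) where
  toFun t := γ (s + ((t : ℝ) : UnitAddCircle))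
  continuous_toFun := by
    have : Continuous fun t : unitInterval => ((t : ℝ) : UnitAddCircle) :=
      (AddCircle.continuous_mk' 1).comp continuous_subtype_val
    fun_prop
  source' := by simp
  target' := by
    have : (((1 : unitInterval) : ℝ) : UnitAddCircle) = 0 := AddCircle.coe_period 1
    rw [this, add_zero]

end FreeLoops

/-- The involution of `ℤΠ` induced by the inversion of loops. -/
noncomputable def overline {X : Type*} [TopologicalSpace X] (a : FreeLoopClass X →₀ ℤ) :
    FreeLoopClass X →₀ ℤ :=
  Finsupp.mapDomain FreeLoopClass.inv a

/-- The additive map `ℤΠ → ℤ` carrying every element of `Π` to `1`. -/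
noncomputable def augmentation (X : Type*) [TopologicalSpace X] :
    (FreeLoopClass X →₀ ℤ) →+ ℤ :=
  Finsupp.liftAddHom fun _ => AddMonoidHom.id ℤ

/-! ### Generic families of closed curves, and oriented links -/

/-- The source of a family of `n` closed curves: `n` circles. -/
abbrev Circles (n : ℕ) : Type := Fin n × UnitAddCircle

/-- A family of `n` parametrized closed curves, as a map of `n` circles. -/
def familyMap {X : Type*} [TopologicalSpace X] {n : ℕ} (γ : Fin n → C(UnitAddCircle, X))
    (p : Circles n) : X := γ p.1 p.2

section Links

variable {X : Type*} [TopologicalSpace X] {n : ℕ}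

/-- A generic family of closed curves: it lies in the union of the interior and the ridge; the
crossings are finite in number, lie in the interior, are double and transversal; at a ridge point
the curve is an arc passing transversally to the ridge from one branch into another one.
Transversality is expressed by local coordinates: near a crossing the two strands run along the
two axes of a chart `ℝ × ℝ → X`; near a ridge point the curve runs, in a chart by a book of `m ≥ 3`
half-planes, along the line perpendicular to the ridge in two different half-planes. -/
structure IsGenericFamily (γ : Fin n → C(UnitAddCircle, X)) : Prop where
  mem : ∀ p, IsInteriorPoint (familyMap γ p) ∨ IsRidgePoint (familyMap γ p)
  crossing_finite :
    {c : Circles n × Circles n | c.1 ≠ c.2 ∧ familyMap γ c.1 = familyMap γ c.2}.Finite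
  crossing_mem : ∀ p q, p ≠ q → familyMap γ p = familyMap γ q → IsInteriorPoint (familyMap γ p)
  crossing_double : ∀ p q r, familyMap γ p = familyMap γ q → familyMap γ q = familyMap γ r →
    p = q ∨ q = r ∨ p = r
  crossing_transversal : ∀ p q, p ≠ q → familyMap γ p = familyMap γ q →
    ∃ φ : ℝ × ℝ → X, IsOpenEmbedding φ ∧ φ (0, 0) = familyMap γ p ∧
      (∀ᶠ r in 𝓝 p, ∃ x : ℝ, familyMap γ r = φ (x, 0)) ∧
      (∀ᶠ r in 𝓝 q, ∃ y : ℝ, familyMap γ r = φ (0, y))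
  ridge_transversal : ∀ p, IsRidgePoint (familyMap γ p) →
    ∃ (m : ℕ) (ψ : Book m → X) (i j : Fin m), 3 ≤ m ∧ IsOpenEmbedding ψ ∧ i ≠ j ∧
      ψ (Book.twoPages i j (0, 0)) = familyMap γ p ∧
      ∀ᶠ r in 𝓝 p, ∃ y : ℝ, familyMap γ r = ψ (Book.twoPages i j (0, y))

/-- A half-branch of a family of `n` closed curves: a parameter `p` and a direction, `true` for
the half of the curve leaving `p` and `false` for the half of the curve arriving at `p`. -/
abbrev HalfBranch (n : ℕ) : Type := Circles n × Bool

/-- An oriented (dotted) link with `n` components in `X`. At a transversal crossing of the strands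
through `p` and `q`, each of the four adjacent areas lies between a half-branch `h` at `p` and a
half-branch `k` at `q`, and is determined by them; `dots h k` says that this area carries a dot.
Exactly two areas, opposite to each other, carry dots at every crossing. -/
@[ext]
structure OrientedLink (X : Type*) [TopologicalSpace X] (n : ℕ) where
  curve : Fin n → C(UnitAddCircle, X)
  generic : IsGenericFamily curve
  dots : HalfBranch n → HalfBranch n → Prop
  dots_crossing : ∀ h k, dots h k →
    h.1 ≠ k.1 ∧ familyMap curve h.1 = familyMap curve k.1
  dots_symm : ∀ h k, dots h k → dots k h
  dots_opposite : ∀ p q a b, dots (p, a) (q, b) → dots (p, !a) (q, !b)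
  dots_adjacent : ∀ p q a b, p ≠ q → familyMap curve p = familyMap curve q →
    (dots (p, a) (q, b) ↔ ¬ dots (p, a) (q, !b))

namespace OrientedLink

/-- The parametrized underlying curves of the link. -/
def pt (L : OrientedLink X n) (p : Circles n) : X := familyMap L.curve p

/-- The mirror image: at every crossing the pair of dots is replaced by the opposite pair. -/
def mirror (L : OrientedLink X n) : OrientedLink X n where
  curve := L.curve
  generic := L.generic
  dots h k := (h.1 ≠ k.1 ∧ familyMap L.curve h.1 = familyMap L.curve k.1) ∧ ¬ L.dots h k
  dots_crossing _ _ h := h.1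
  dots_symm _ _ H := ⟨⟨H.1.1.symm, H.1.2.symm⟩, fun H' => H.2 (L.dots_symm _ _ H')⟩
  dots_opposite p q a b H := by
    refine ⟨H.1, fun H' => H.2 ?_⟩
    simpa using L.dots_opposite p q _ _ H'
  dots_adjacent p q a b hne hpq := by
    have := L.dots_adjacent p q a b hne hpq
    simp only [ne_eq, hne, not_false_eq_true, hpq, and_self, true_and]
    tauto

/-- The reversal of the parameter on each of the `n` circles. -/
def flip (p : Circles n) : Circles n := (p.1, -p.2)

theorem flip_flip (p : Circles n) : flip (flip p) = p := by simp [flip]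

theorem flip_injective : Function.Injective (flip (n := n)) :=
  Function.LeftInverse.injective flip_flip

theorem continuous_flip : Continuous (flip (n := n)) := by
  unfold flip; fun_prop

theorem generic_flip {γ : Fin n → C(UnitAddCircle, X)} (h : IsGenericFamily γ) :
    IsGenericFamily fun i => (γ i).comp circleNeg := by
  have key : ∀ p, familyMap (fun i => (γ i).comp circleNeg) p = familyMap γ (flip p) :=
    fun _ => rfl
  have tend : ∀ p : Circles n, Filter.Tendsto flip (𝓝 p) (𝓝 (flip p)) :=
    fun p => continuous_flip.tendsto p
  constructor
  · intro p; rw [key]; exact h.mem _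
  · refine (h.crossing_finite.preimage
      (f := fun c : Circles n × Circles n => (flip c.1, flip c.2)) ?_).subset ?_
    · exact (flip_injective.prodMap flip_injective).injOn
    · rintro ⟨p, q⟩ ⟨h1, h2⟩
      exact ⟨fun e => h1 (flip_injective e), h2⟩
  · intro p q hne hpq
    exact h.crossing_mem _ _ (fun e => hne (flip_injective e)) hpq
  · intro p q r h1 h2
    rcases h.crossing_double (flip p) (flip q) (flip r) h1 h2 with e | e | e
    · exact Or.inl (flip_injective e)
    · exact Or.inr (Or.inl (flip_injective e))
    · exact Or.inr (Or.inr (flip_injective e))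
  · intro p q hne hpq
    obtain ⟨φ, h1, h2, h3, h4⟩ :=
      h.crossing_transversal _ _ (fun e => hne (flip_injective e)) hpq
    exact ⟨φ, h1, h2, (tend p).eventually h3, (tend q).eventually h4⟩
  · intro p hp
    obtain ⟨m, ψ, i, j, h1, h2, h3, h4, h5⟩ := h.ridge_transversal (flip p) hp
    exact ⟨m, ψ, i, j, h1, h2, h3, h4, (tend p).eventually h5⟩

/-- The link `-L`: the same curves and dots, with all orientations reversed. -/
def reverse (L : OrientedLink X n) : OrientedLink X n where
  curve i := (L.curve i).comp circleNeg
  generic := generic_flip L.generic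
  dots h k := L.dots (flip h.1, !h.2) (flip k.1, !k.2)
  dots_crossing _ _ H :=
    ⟨fun e => (L.dots_crossing _ _ H).1 (congrArg flip e), (L.dots_crossing _ _ H).2⟩
  dots_symm _ _ H := L.dots_symm _ _ H
  dots_opposite _ _ _ _ H := L.dots_opposite _ _ _ _ H
  dots_adjacent _ _ _ _ hne hpq :=
    L.dots_adjacent _ _ _ _ (fun e => hne (flip_injective e)) hpq

/-! ### Isotopy -/

/-- The same oriented link up to the choice of parametrizations of the components
(orientation preserving homeomorphisms of `ℝ/ℤ`, given by their lifts `f i : ℝ → ℝ`)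
and of the numeration `σ` of the components. -/
def SameLink (L L' : OrientedLink X n) : Prop :=
  ∃ (σ : Equiv.Perm (Fin n)) (f : Fin n → ℝ ≃o ℝ),
    (∀ i x, f i (x + 1) = f i x + 1) ∧
    (∀ i (x : ℝ), L'.curve i (x : UnitAddCircle) = L.curve (σ i) (f i x : UnitAddCircle)) ∧
    ∀ i (x : ℝ) a j (y : ℝ) b,
      L'.dots ((i, (x : UnitAddCircle)), a) ((j, (y : UnitAddCircle)), b) ↔
        L.dots ((σ i, (f i x : UnitAddCircle)), a) ((σ j, (f j y : UnitAddCircle)), b)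

/-- `L'` is the image of `L` under the end homeomorphism of an ambient isotopy of `X`. -/
def AmbientIsotopic (L L' : OrientedLink X n) : Prop :=
  ∃ H : C(unitInterval × X, X), (∀ x, H (0, x) = x) ∧
    (∀ t, IsHomeomorph fun x => H (t, x)) ∧
    (∀ p, L'.pt p = H (1, L.pt p)) ∧ ∀ h k, L'.dots h k ↔ L.dots h k

end OrientedLink

/-- A proper closed arc on one of `n` circles, with an affine parametrization by `[-1, 1]`
compatible or not with the orientation of the circle, according to the sign of `half`. -/
structure Arc (n : ℕ) where
  comp : Fin n
  mid : ℝ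
  half : ℝ
  half_ne : half ≠ 0
  half_lt : |half| < 1 / 2

/-- The point of the arc with coordinate `s`. -/
noncomputable def Arc.pt (e : Arc n) (s : ℝ) : Circles n :=
  (e.comp, ((e.mid + s * e.half : ℝ) : UnitAddCircle))

/-- The half-branch at the point with coordinate `s` of the arc along which the coordinate
increases (for `a = true`), respectively decreases (for `a = false`) away from this point. -/
noncomputable def Arc.side (e : Arc n) (s : ℝ) (a : Bool) : HalfBranch n :=
  (e.pt s, if 0 < e.half then a else !a)

/-- The set of points of a finite family of arcs. -/
def arcsSupport {k : ℕ} (e : Fin k → Arc n) : Set (Circles n) :=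
  {p | ∃ i, ∃ s ∈ Icc (-1 : ℝ) 1, (e i).pt s = p}

/-- The links `L` and `L'` meet the set `D` along the arcs `u i`, respectively `u' i`
(parametrized by `[-1, 1]`, and corresponding to each other under the parametrizations of the
links), and coincide, together with the dots at the crossings, outside of `D`. -/
structure Replaces (L L' : OrientedLink X n) (D : Set X) {k : ℕ} (e : Fin k → Arc n)
    (u u' : Fin k → ℝ → X) : Prop where
  disjoint : ∀ i j, ∀ s ∈ Icc (-1 : ℝ) 1, ∀ t ∈ Icc (-1 : ℝ) 1,
    (e i).pt s = (e j).pt t → i = j ∧ s = t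
  before : ∀ i, ∀ s ∈ Icc (-1 : ℝ) 1, L.pt ((e i).pt s) = u i s
  after : ∀ i, ∀ s ∈ Icc (-1 : ℝ) 1, L'.pt ((e i).pt s) = u' i s
  before_mem : ∀ p, L.pt p ∈ D ↔ p ∈ arcsSupport e
  after_mem : ∀ p, L'.pt p ∈ D ↔ p ∈ arcsSupport e
  pt_eq : ∀ p, p ∉ arcsSupport e → L'.pt p = L.pt p
  dots_iff : ∀ h k, h.1 ∉ arcsSupport e → k.1 ∉ arcsSupport e → (L'.dots h k ↔ L.dots h k)

/-- The square `[-1, 1] × [-1, 1]`. -/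
def square : Set (ℝ × ℝ) := Icc (-1) 1 ×ˢ Icc (-1) 1

/-- The oriented basic moves. Each of the moves `M₁ - M₆` is a picture in a fixed piece of surface
or of a book of half-planes, transported into `X`; all choices of the orientations of the strands
and of the dots compatible with the picture are allowed. -/
inductive BasicMove : OrientedLink X n → OrientedLink X n → Prop
  /-- `M₁^±`: a segment acquires a kink, with any dots at the new crossing. -/
  | M1 (L L' : OrientedLink X n) (φ : ℝ × ℝ → X) (hφ : IsOpenEmbedding φ) (e : Fin 1 → Arc n)
      (h : Replaces L L' (φ '' square) e
        ![fun s => φ (s, 0)]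
        ![fun s => φ (s * (4 * s ^ 2 - 1) / 3, (1 - s ^ 2) / 2)]) :
      BasicMove L L'
  /-- `M₂`: two disjoint strands are pushed across each other, creating a bigon with corners at the
  coordinates `-1/2` and `1/2`; one strand lies above the other one, which means that the bigon is
  dotted at precisely one of its two corners. -/
  | M2 (L L' : OrientedLink X n) (φ : ℝ × ℝ → X) (hφ : IsOpenEmbedding φ) (e : Fin 2 → Arc n)
      (h : Replaces L L' (φ '' square) e
        ![fun s => φ (s, 1 / 2), fun s => φ (s, -1 / 2)]
        ![fun s => φ (s, (4 * s ^ 2 - 1) / 6), fun s => φ (s, -(4 * s ^ 2 - 1) / 6)])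
      (hdots : L'.dots ((e 0).side (-1 / 2) true) ((e 1).side (-1 / 2) true) ↔
        ¬ L'.dots ((e 0).side (1 / 2) false) ((e 1).side (1 / 2) false)) :
      BasicMove L L'
  /-- `M₃`: strand `0` is pushed across the crossing of the strands `1` and `2`. The dots at the
  three crossings are carried along; the strands are linearly ordered by height, which means that
  the three corners of the triangle are neither all dotted nor all undotted. -/
  | M3 (L L' : OrientedLink X n) (φ : ℝ × ℝ → X) (hφ : IsOpenEmbedding φ) (e : Fin 3 → Arc n)
      (h : Replaces L L' (φ '' square) e
        ![fun s => φ (s, -(2 * (1 - s ^ 2)) / 3), fun s => φ (s, s), fun s => φ (s, -s)]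
        ![fun s => φ (s, 2 * (1 - s ^ 2) / 3), fun s => φ (s, s), fun s => φ (s, -s)])
      (h01 : ∀ a b, L'.dots ((e 0).side (1 / 2) a) ((e 1).side (1 / 2) b) ↔
        L.dots ((e 0).side (-1 / 2) a) ((e 1).side (-1 / 2) b))
      (h02 : ∀ a b, L'.dots ((e 0).side (-1 / 2) a) ((e 2).side (-1 / 2) b) ↔
        L.dots ((e 0).side (1 / 2) a) ((e 2).side (1 / 2) b))
      (h12 : ∀ a b, L'.dots ((e 1).side 0 a) ((e 2).side 0 b) ↔
        L.dots ((e 1).side 0 a) ((e 2).side 0 b))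
      (horder : ¬ ((L.dots ((e 0).side (-1 / 2) true) ((e 1).side (-1 / 2) true) ↔
            L.dots ((e 0).side (1 / 2) false) ((e 2).side (1 / 2) false)) ∧
          (L.dots ((e 0).side (1 / 2) false) ((e 2).side (1 / 2) false) ↔
            L.dots ((e 1).side 0 false) ((e 2).side 0 true)))) :
      BasicMove L L'
  /-- `M₄`: a strand is pushed from the branch `j` across the ridge into the branch `i`. -/
  | M4 (L L' : OrientedLink X n) (m : ℕ) (hm : 3 ≤ m) (ψ : Book m → X) (hψ : IsOpenEmbedding ψ)
      (i j : Fin m) (hij : i ≠ j) (e : Fin 1 → Arc n)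
      (h : Replaces L L' ((fun z => ψ (Book.twoPages i j z)) '' square) e
        ![fun s => ψ (Book.twoPages i j (s, -1 / 2))]
        ![fun s => ψ (Book.twoPages i j (s, -(4 * s ^ 2 - 1) / 6))]) :
      BasicMove L L'
  /-- `M₅^±`: a crossing is pushed from the branch `j` across the ridge into the branch `i`,
  together with its dots. -/
  | M5 (L L' : OrientedLink X n) (m : ℕ) (hm : 3 ≤ m) (ψ : Book m → X) (hψ : IsOpenEmbedding ψ)
      (i j : Fin m) (hij : i ≠ j) (e : Fin 2 → Arc n)
      (h : Replaces L L' ((fun z => ψ (Book.twoPages i j z)) '' square) e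
        ![fun s => ψ (Book.twoPages i j ((3 * s + 2 * (1 - s ^ 2)) / 6, s)),
          fun s => ψ (Book.twoPages i j (-(3 * s + 2 * (1 - s ^ 2)) / 6, s))]
        ![fun s => ψ (Book.twoPages i j ((3 * s - 2 * (1 - s ^ 2)) / 6, s)),
          fun s => ψ (Book.twoPages i j (-(3 * s - 2 * (1 - s ^ 2)) / 6, s))])
      (hdots : ∀ a b, L'.dots ((e 0).side (1 / 2) a) ((e 1).side (1 / 2) b) ↔
        L.dots ((e 0).side (-1 / 2) a) ((e 1).side (-1 / 2) b)) :
      BasicMove L L'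
  /-- `M₆`: a strand passing across the ridge from the branch `i` into the branch `j` is pushed
  into a third branch `k`, so that it passes from `i` into `k` and then from `k` into `j`. -/
  | M6 (L L' : OrientedLink X n) (m : ℕ) (ψ : Book m → X) (hψ : IsOpenEmbedding ψ)
      (i j k : Fin m) (hij : i ≠ j) (hik : i ≠ k) (hjk : j ≠ k) (e : Fin 1 → Arc n)
      (h : Replaces L L'
        (ψ '' {b | ∃ l, (l = i ∨ l = j ∨ l = k) ∧ ∃ x ∈ Icc (-1 : ℝ) 1, ∃ y ∈ Icc (0 : ℝ) 1,
          b = Book.page l x y}) e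
        ![fun s => ψ (if s ≤ 0 then Book.page i s (-s) else Book.page j s s)]
        ![fun s => ψ (if s ≤ -1 / 2 then Book.page i s ((4 * s ^ 2 - 1) / 3)
          else if s ≤ 1 / 2 then Book.page k s ((1 - 4 * s ^ 2) / 3)
          else Book.page j s ((4 * s ^ 2 - 1) / 3))]) :
      BasicMove L L'
  /-- `M₇`: in the disc `D = C(S)` centered at a singular point `x`, where `S` is a circle in the
  graph `Γ`, an embedded arc with endpoints on `∂D` is replaced with another embedded arc with the
  same endpoints. (As `L'` is generic, the new arc avoids `x` and is transversal to the ridge.) -/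
  | M7 (L L' : OrientedLink X n) (x : X) (hx : IsSingularPoint x) (Γ : FiniteGraph)
      (f : Cone Γ.Space → X) (hf : IsConeChart x Γ f) (S : Set Γ.Space)
      (hS : Nonempty (S ≃ₜ Circle)) (e : Fin 1 → Arc n) (u u' : ℝ → X)
      (hu : InjOn u (Icc (-1) 1)) (hu' : InjOn u' (Icc (-1) 1))
      (hl : u' (-1) = u (-1)) (hr : u' 1 = u 1)
      (hl_mem : ∃ t ∈ S, u (-1) = f (Cone.mk t 1)) (hr_mem : ∃ t ∈ S, u 1 = f (Cone.mk t 1))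
      (h : Replaces L L' {y | ∃ t ∈ S, ∃ r, y = f (Cone.mk t r)} e ![u] ![u']) :
      BasicMove L L'

namespace OrientedLink

/-- Isotopy of oriented links: the equivalence relation generated by ambient isotopies and the
oriented basic moves (and by changes of parametrizations). -/
def Isotopic : OrientedLink X n → OrientedLink X n → Prop :=
  Relation.EqvGen fun L L' => SameLink L L' ∨ AmbientIsotopic L L' ∨ BasicMove L L'

/-! ### The linking number and the linking class -/

/-- The crossings of the two components of a 2-component link with each other. -/
def InterCrossing (L : OrientedLink X 2) : Type :=
  {c : UnitAddCircle × UnitAddCircle // L.curve 0 c.1 = L.curve 1 c.2}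

theorem finite_interCrossing (L : OrientedLink X 2) : Finite L.InterCrossing := by
  have hfin := L.generic.crossing_finite.to_subtype
  refine Finite.of_injective (fun c : L.InterCrossing =>
    (⟨(((0 : Fin 2), c.1.1), ((1 : Fin 2), c.1.2)), ?_, c.2⟩ :
      {c : Circles 2 × Circles 2 |
        c.1 ≠ c.2 ∧ familyMap L.curve c.1 = familyMap L.curve c.2})) ?_
  · intro h
    exact absurd (congrArg Prod.fst h) (show (0 : Fin 2) ≠ 1 by decide)
  · rintro ⟨⟨s, t⟩, h⟩ ⟨⟨s', t'⟩, h'⟩ e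
    simp only [Subtype.mk.injEq, Prod.mk.injEq, true_and] at e
    exact Subtype.ext (Prod.ext e.1 e.2)

noncomputable instance (L : OrientedLink X 2) : Fintype L.InterCrossing :=
  @Fintype.ofFinite _ L.finite_interCrossing

open Classical in
/-- The sign of a crossing: `+1` if the dots lie in the area between the two outgoing half-branches
and in the area between the two incoming half-branches, and `-1` if they lie in the other two. -/
noncomputable def sign (L : OrientedLink X n) (p q : Circles n) : ℤ :=
  if L.dots (p, true) (q, true) then 1 else -1

/-- The sign of a crossing of the two components. -/
noncomputable def crossingSign (L : OrientedLink X 2) (c : L.InterCrossing) : ℤ :=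
  L.sign (0, c.1.1) (1, c.1.2)

/-- The loop obtained by smoothing a crossing of the two components: it goes from the crossing
once along the first component, then once along the second one. -/
noncomputable def smoothing (L : OrientedLink X 2) (c : L.InterCrossing) :
    Path (L.curve 0 c.1.1) (L.curve 0 c.1.1) :=
  (loopFrom (L.curve 0) c.1.1).trans ((loopFrom (L.curve 1) c.1.2).cast c.2 c.2)

/-- The linking number. -/
noncomputable def lk (L : OrientedLink X 2) : ℤ := ∑ c : L.InterCrossing, L.crossingSign c

/-- The linking class, an element of the free abelian group with basis `Π`. -/
noncomputable def LK (L : OrientedLink X 2) : FreeLoopClass X →₀ ℤ :=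
  ∑ c : L.InterCrossing, Finsupp.single (FreeLoopClass.ofPath (L.smoothing c)) (L.crossingSign c)

end OrientedLink

end Links

/-! ### Free homotopy classes of closed paths -/

section FreeLoopClasses

variable {X : Type*} [TopologicalSpace X]

/-! Invariance is checked on the generators of isotopy; each time the crossings of the two
components are matched and their signs and smoothed loops compared.

A basic move changes the link only inside a simply connected set `D`: a square, a star-shaped piece
of a book, or a cone. It replaces arcs in `D` by arcs in `D` with the same endpoints. Joining old
and new points by constant paths outside `D` and by arbitrary paths in `D`, the old curve is
transported to the new one up to homotopy (`ArcwiseReplaced.transported`): the relevant squares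
commute inside `D` because `D` is simply connected, and trivially outside. At a crossing, one path
transports the loops of both components at once, so the free homotopy class of the smoothing is
preserved (`ArcwiseReplaced.ofPath_smoothing_eq`).

The bookkeeping of crossings is uniform because the pictures of the moves are symmetric: the
parameter reflection `s ↦ -s` of every arc matches crossings. For `M₃` and `M₅` it carries the
crossings before the move to those after it, with the same signs (`Replaces.LK_eq`). For `M₂` it
exchanges the two corners of the bigon, whose signs are opposite and whose classes agree, so that
they cancel (`Replaces.LK_eq_of_cancel`). The moves `M₁`, `M₄`, `M₆`, `M₇` involve one arc, hence no
crossing of different components in `D` (`Replaces.LK_eq_of_single`).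

An ambient isotopy itself supplies the free homotopies of the smoothed loops; a reparametrization or
renumbering alters them only by a homotopy and a cyclic rotation. The remaining three statements
hold term by term in the sum. -/

theorem Path.circleMap_coe {x : X} (p : Path x x) {t : ℝ} (ht : t ∈ Ico (0 : ℝ) 1) :
    p.circleMap (t : UnitAddCircle) = p.extend t :=
  AddCircle.liftIco_zero_coe_apply (p := (1 : ℝ)) (f := p.extend) ht

theorem Path.circleMap_coe_unitInterval {x : X} (p : Path x x) (t : unitInterval) :
    p.circleMap ((t : ℝ) : UnitAddCircle) = p t := by
  rcases eq_or_lt_of_le t.2.2 with h | h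
  · have : t = 1 := Subtype.ext h
    subst this
    have h1 : (((1 : unitInterval) : ℝ) : UnitAddCircle) = ((0 : ℝ) : UnitAddCircle) := by
      simp
    rw [h1, p.circleMap_coe (by simp)]
    simp
  · rw [p.circleMap_coe ⟨t.2.1, h⟩, Path.extend_apply _ t.2]

theorem UnitAddCircle.exists_coe_unitInterval (s : UnitAddCircle) :
    ∃ t : unitInterval, ((t : ℝ) : UnitAddCircle) = s := by
  have hs : s ∈ ((↑) : ℝ → UnitAddCircle) '' Ico 0 (0 + 1) := by
    rw [AddCircle.coe_image_Ico_eq (1 : ℝ) 0]; trivial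
  obtain ⟨t, ht, rfl⟩ := hs
  exact ⟨⟨t, ht.1, by linarith [ht.2]⟩, rfl⟩

/-- A continuous family of closed paths is a free homotopy. -/
theorem FreeLoopClass.ofPath_eq_of_family {x y : X} (p : Path x x) (q : Path y y)
    (H : C(unitInterval × unitInterval, X)) (h0 : ∀ t, H (0, t) = p t) (h1 : ∀ t, H (1, t) = q t)
    (hH : ∀ τ, H (τ, 0) = H (τ, 1)) : ofPath p = ofPath q := by
  -- The family is read as a closed path in the function space `C(unitInterval, X)`. Its circle map
  -- then provides the free homotopy by evaluation, so gluing is done only for a single closed path.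
  let c : unitInterval → C(unitInterval, X) := fun t => ⟨fun τ => H (τ, t), by fun_prop⟩
  have hc : Continuous c :=
    ContinuousMap.continuous_of_continuous_uncurry _
      (show Continuous fun z : unitInterval × unitInterval => H (z.2, z.1) by fun_prop)
  have hc01 : c 0 = c 1 := ContinuousMap.ext hH
  let P : Path (c 0) (c 0) := ⟨⟨c, hc⟩, rfl, hc01.symm⟩
  have hP : ∀ t : unitInterval, P.circleMap ((t : ℝ) : UnitAddCircle) = c t :=
    P.circleMap_coe_unitInterval
  refine Quotient.sound ⟨⟨⟨fun z => P.circleMap z.2 z.1, ?_⟩, ?_, ?_⟩⟩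
  · have h2 : Continuous fun z : unitInterval × UnitAddCircle => (P.circleMap z.2, z.1) := by
      fun_prop
    exact continuous_eval.comp h2
  · intro s
    obtain ⟨t, rfl⟩ := UnitAddCircle.exists_coe_unitInterval s
    change P.circleMap ((t : ℝ) : UnitAddCircle) 0 = _
    rw [hP, p.circleMap_coe_unitInterval]
    exact h0 t
  · intro s
    obtain ⟨t, rfl⟩ := UnitAddCircle.exists_coe_unitInterval s
    change P.circleMap ((t : ℝ) : UnitAddCircle) 1 = _
    rw [hP, q.circleMap_coe_unitInterval]
    exact h1 t

theorem FreeLoopClass.ofPath_eq_of_homotopic {x : X} {p q : Path x x} (h : p.Homotopic q) :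
    ofPath p = ofPath q := by
  obtain ⟨F⟩ := h
  exact ofPath_eq_of_family p q F.toContinuousMap (fun t => F.map_zero_left t)
    (fun t => F.map_one_left t) (fun τ => (F.source τ).trans (F.target τ).symm)

/-- The basepoint of a closed path can be moved along the path. -/
theorem FreeLoopClass.ofPath_trans_comm {x y : X} (p : Path x y) (q : Path y x) :
    ofPath (p.trans q) = ofPath (q.trans p) := by
  set r := (p.trans q).circleMap with hr
  have hval : ∀ t : unitInterval, r ((t : ℝ) : UnitAddCircle) = (p.trans q) t :=
    (p.trans q).circleMap_coe_unitInterval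
  have hper : ∀ a : ℝ, ((a + 1 : ℝ) : UnitAddCircle) = (a : UnitAddCircle) := fun a => by
    rw [AddCircle.coe_add, AddCircle.coe_period, add_zero]
  -- The homotopy rotates the circle by half a turn, because the junction of `p` and `q` sits at
  -- parameter `1/2`.
  let H : C(unitInterval × unitInterval, X) :=
    ⟨fun z => r (((z.2 : ℝ) + (z.1 : ℝ) / 2 : ℝ) : UnitAddCircle), by
      have : Continuous fun z : unitInterval × unitInterval =>
          (((z.2 : ℝ) + (z.1 : ℝ) / 2 : ℝ) : UnitAddCircle) :=
        (AddCircle.continuous_mk' 1).comp (by fun_prop)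
      fun_prop⟩
  refine ofPath_eq_of_family _ _ H (fun t => ?_) (fun t => ?_) (fun τ => ?_)
  · change r (((t : ℝ) + ((0 : unitInterval) : ℝ) / 2 : ℝ) : UnitAddCircle) = _
    rw [← hval]; simp
  · change r (((t : ℝ) + ((1 : unitInterval) : ℝ) / 2 : ℝ) : UnitAddCircle) = _
    have ht0 := t.2.1
    have ht1 := t.2.2
    by_cases h : (t : ℝ) ≤ 1 / 2
    · have e := hval ⟨(t : ℝ) + 1 / 2, by linarith, by linarith⟩
      simp only [Icc.coe_one]
      refine e.trans ?_
      rw [Path.trans_apply, Path.trans_apply, dif_pos h]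
      split_ifs with h'
      -- Both halves apply only at `t = 0`, the junction point `y`.
      · have ht : (t : ℝ) = 0 := le_antisymm (by simpa using h') ht0
        have h3 : p 1 = q 0 := by simp
        convert h3 using 2 <;> ext <;> simp [ht]
      · congr 1; ext; simp; ring
    · have e := hval ⟨(t : ℝ) - 1 / 2, by linarith, by linarith⟩
      have h2 : (((t : ℝ) + ((1 : unitInterval) : ℝ) / 2 : ℝ) : UnitAddCircle) =
          (((t : ℝ) - 1 / 2 : ℝ) : UnitAddCircle) := by
        rw [← hper ((t : ℝ) - 1 / 2)]; congr 1; simp; ring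
      rw [h2]
      refine e.trans ?_
      rw [Path.trans_apply, Path.trans_apply, dif_neg h, dif_pos (by simp; linarith)]
      congr 1; ext; simp; ring
  · change r (((((0 : unitInterval) : ℝ)) + (τ : ℝ) / 2 : ℝ) : UnitAddCircle) =
      r (((((1 : unitInterval) : ℝ)) + (τ : ℝ) / 2 : ℝ) : UnitAddCircle)
    rw [← hper]; congr 2; simp; ring

/-- Two closed paths with a common basepoint can be transported simultaneously along a path. -/
theorem FreeLoopClass.ofPath_trans_cast_eq {x y x' y' : X} (a : Path x x) (b : Path y y)
    (h : x = y) (a' : Path x' x') (b' : Path y' y') (h' : x' = y') (δ : Path x x')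
    (ε : Path y y') (hδ : ∀ t, δ t = ε t) (ha : (a.trans δ).Homotopic (δ.trans a'))
    (hb : (b.trans ε).Homotopic (ε.trans b')) :
    ofPath (a.trans (b.cast h h)) = ofPath (a'.trans (b'.cast h' h')) := by
  subst h h'
  obtain rfl : δ = ε := Path.ext (funext hδ)
  simp only [Path.cast_rfl_rfl]
  -- Both loops are conjugated by the same `δ`. Freely, the conjugating path can be rotated to the
  -- end, where it cancels.
  have h1 : (δ.symm.trans ((a.trans b).trans δ)).Homotopic (a'.trans b') := by
    rw [← Path.Homotopic.Quotient.eq] at ha hb ⊢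
    simp only [Path.Homotopic.Quotient.mk_trans, Path.Homotopic.Quotient.mk_symm] at *
    rw [Path.Homotopic.Quotient.trans_assoc, hb]
    grind
  have h2 : (((a.trans b).trans δ).trans δ.symm).Homotopic (a.trans b) := by
    rw [← Path.Homotopic.Quotient.eq]
    simp
  rw [← ofPath_eq_of_homotopic h1, ofPath_trans_comm δ.symm, ofPath_eq_of_homotopic h2]

end FreeLoopClasses

/-! ### Paths along a parametrized curve -/

section Segments

variable {X : Type*} [TopologicalSpace X]

/-- Paths through which a curve `g : ℝ → X` is run between the same parameters are homotopic. -/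
theorem homotopic_of_lift_real {x y : X} (g : ℝ → X) (hg : Continuous g) (p q : Path x y)
    (u v : unitInterval → ℝ) (hu : Continuous u) (hv : Continuous v) (h0 : u 0 = v 0)
    (h1 : u 1 = v 1) (hp : ∀ t, p t = g (u t)) (hq : ∀ t, q t = g (v t)) : p.Homotopic q := by
  -- Linear interpolation of the two parameter functions in `ℝ`, composed with `g`.
  refine ⟨⟨⟨⟨fun z => g ((1 - (z.1 : ℝ)) * u z.2 + z.1 * v z.2), by fun_prop⟩, ?_, ?_⟩, ?_⟩⟩
  · intro t; simp [hp]
  · intro t; simp [hq]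
  · intro τ t ht
    rcases ht with rfl | ht
    · simp [hp, h0, ← add_mul]
    · rw [mem_singleton_iff] at ht
      subst ht
      simp [hp, h1, ← add_mul]

/-- The path `p` runs along the curve `g` from the parameter `a` to the parameter `b`. -/
def IsSegment (g : ℝ → X) (a b : ℝ) {x y : X} (p : Path x y) : Prop :=
  ∀ t : unitInterval, p t = g (a + t * (b - a))

namespace IsSegment

variable {g : ℝ → X} {a b c : ℝ} {x y z : X}

theorem source {p : Path x y} (h : IsSegment g a b p) : x = g a := by
  have := h 0; simpa using this

theorem target {p : Path x y} (h : IsSegment g a b p) : y = g b := by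
  have := h 1; simpa using this

theorem exists_path (hg : Continuous g) (a b : ℝ) : ∃ p : Path (g a) (g b), IsSegment g a b p :=
  ⟨⟨⟨fun t => g (a + t * (b - a)), by fun_prop⟩, by simp, by simp⟩, fun _ => rfl⟩

/-- Both sides factor through `g` by parameter paths in `ℝ` from `a` to `c`, and any two such paths
are homotopic. -/
theorem trans_homotopic (hg : Continuous g) {p : Path x y} {q : Path y z} {r : Path x z}
    (hp : IsSegment g a b p) (hq : IsSegment g b c q) (hr : IsSegment g a c r) :
    (p.trans q).Homotopic r := by
  obtain rfl := hp.source
  obtain rfl := hp.target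
  obtain rfl := hq.target
  let P : Path a b := ⟨⟨fun t => a + t * (b - a), by fun_prop⟩, by simp, by simp⟩
  let Q : Path b c := ⟨⟨fun t => b + t * (c - b), by fun_prop⟩, by simp, by simp⟩
  refine homotopic_of_lift_real g hg _ _ (P.trans Q) (fun t => a + t * (c - a)) (by fun_prop)
    (by fun_prop) (by simp) (by simp) (fun t => ?_) hr
  rw [Path.trans_apply, Path.trans_apply]
  split_ifs
  · exact hp _
  · exact hq _

theorem add_period {k : ℝ} (hk : ∀ s, g (s + k) = g s) {p : Path x y} (hp : IsSegment g a b p) :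
    IsSegment g (a + k) (b + k) p := by
  intro t
  rw [hp t, ← hk]; congr 1; ring

end IsSegment

theorem isSegment_loopFrom (γ : C(UnitAddCircle, X)) (s : ℝ) :
    IsSegment (fun r : ℝ => γ r) s (s + 1) (loopFrom γ (s : UnitAddCircle)) := by
  intro t
  change γ ((s : UnitAddCircle) + ((t : ℝ) : UnitAddCircle)) = _
  rw [← AddCircle.coe_add]; congr 3; ring

end Segments

/-! ### Transport of loops along a replacement in a simply connected set -/

section Transport

variable {X : Type*} [TopologicalSpace X] {D : Set X}

theorem IsSimplyConnected.homotopic (hD : IsSimplyConnected D) {x y : X} {p q : Path x y}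
    (hp : ∀ t, p t ∈ D) (hq : ∀ t, q t ∈ D) : p.Homotopic q := by
  have := hD.simplyConnectedSpace
  have hx : x ∈ D := by simpa using hp 0
  have hy : y ∈ D := by simpa using hp 1
  let P : Path (⟨x, hx⟩ : D) ⟨y, hy⟩ :=
    ⟨⟨fun t => ⟨p t, hp t⟩, by fun_prop⟩, by simp, by simp⟩
  let Q : Path (⟨x, hx⟩ : D) ⟨y, hy⟩ :=
    ⟨⟨fun t => ⟨q t, hq t⟩, by fun_prop⟩, by simp, by simp⟩
  exact (SimplyConnectedSpace.paths_homotopic P Q).map ⟨Subtype.val, continuous_subtype_val⟩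

theorem Path.trans_mem {x y z : X} {p : Path x y} {q : Path y z} (hp : ∀ t, p t ∈ D)
    (hq : ∀ t, q t ∈ D) (t : unitInterval) : p.trans q t ∈ D := by
  rw [Path.trans_apply]; split_ifs
  · exact hp _
  · exact hq _

/-- A path which lies in `D` or is constant. -/
def IsTrack (D : Set X) {x y : X} (π : Path x y) : Prop :=
  (∀ t, π t ∈ D) ∨ ∀ t, π t = x

theorem IsTrack.mem {x y : X} {π : Path x y} (h : IsTrack D π) (hx : x ∈ D) (t : unitInterval) :
    π t ∈ D := by
  rcases h with h | h
  · exact h t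
  · rw [h t]; exact hx

/-- Tracks starting in `D` stay in `D`, and those starting outside are constant. Hence a track is
determined by its endpoints up to homotopy, and the choice of tracks never matters. -/
theorem IsTrack.homotopic (hD : IsSimplyConnected D) {x y : X} {π ρ : Path x y}
    (hπ : IsTrack D π) (hρ : IsTrack D ρ) : π.Homotopic ρ := by
  by_cases hx : x ∈ D
  · exact hD.homotopic (hπ.mem hx) (hρ.mem hx)
  · rcases hπ with h | h
    · exact absurd (by simpa using h 0) hx
    rcases hρ with h' | h'
    · exact absurd (by simpa using h' 0) hx
    have : π = ρ := Path.ext (funext fun t => (h t).trans (h' t).symm)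
    rw [this]

theorem isTrack_refl (x : X) : IsTrack D (Path.refl x) := Or.inr fun _ => rfl

/-- The segments of the curves `g` and `g'` between the parameters `a` and `b` correspond to each
other under the tracks joining their endpoints. -/
def Transported (D : Set X) (g g' : ℝ → X) (a b : ℝ) : Prop :=
  ∀ ⦃x y x' y' : X⦄ (p : Path x y) (p' : Path x' y') (π : Path x x') (ρ : Path y y'),
    IsSegment g a b p → IsSegment g' a b p' → IsTrack D π → IsTrack D ρ →
      (p.trans ρ).Homotopic (π.trans p')

/-- Between the parameters `a` and `b`, both curves stay in `D`, or they coincide. -/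
def Compatible (D : Set X) (g g' : ℝ → X) (a b : ℝ) : Prop :=
  (∀ z ∈ uIcc a b, g z ∈ D ∧ g' z ∈ D) ∨ ∀ z ∈ uIcc a b, g z = g' z

theorem Compatible.symm {X : Type*} {D : Set X} {g g' : ℝ → X} {a b : ℝ}
    (h : Compatible D g g' a b) : Compatible D g g' b a := by
  unfold Compatible; rwa [uIcc_comm]

theorem add_mul_sub_mem_uIcc (a b : ℝ) (t : unitInterval) : a + t * (b - a) ∈ uIcc a b := by
  rw [← segment_eq_uIcc]
  exact ⟨1 - t, t, by linarith [t.2.2], t.2.1, by ring, by simp; ring⟩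

/-- Either the whole square of paths lies in the simply connected set `D`, or the two segments
coincide and the tracks are null-homotopic closed paths. -/
theorem Compatible.transported (hD : IsSimplyConnected D) {g g' : ℝ → X} {a b : ℝ}
    (h : Compatible D g g' a b) : Transported D g g' a b := by
  intro x y x' y' p p' π ρ hp hp' hπ hρ
  rcases h with h | h
  · have hx : x ∈ D := by rw [hp.source]; exact (h a left_mem_uIcc).1
    have hy : y ∈ D := by rw [hp.target]; exact (h b right_mem_uIcc).1
    refine hD.homotopic (Path.trans_mem (fun t => ?_) (hρ.mem hy))
      (Path.trans_mem (hπ.mem hx) fun t => ?_)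
    · rw [hp t]; exact (h _ (add_mul_sub_mem_uIcc a b t)).1
    · rw [hp' t]; exact (h _ (add_mul_sub_mem_uIcc a b t)).2
  · have hx : x = x' := by rw [hp.source, hp'.source]; exact h a left_mem_uIcc
    have hy : y = y' := by rw [hp.target, hp'.target]; exact h b right_mem_uIcc
    subst hx hy
    have hpp : p = p' := Path.ext (funext fun t => by
      rw [hp t, hp' t]; exact h _ (add_mul_sub_mem_uIcc a b t))
    subst hpp
    have h1 := hπ.homotopic hD (isTrack_refl x)
    have h2 := hρ.homotopic hD (isTrack_refl y)
    exact (((Path.Homotopic.refl p).hcomp h2).trans (Path.Homotopic.trans_refl p)).trans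
      ((h1.hcomp (Path.Homotopic.refl p)).trans (Path.Homotopic.refl_trans p)).symm

/-- Two homotopy-commutative squares are pasted along a track over `b`. -/
theorem Transported.trans {g g' : ℝ → X} (hg : Continuous g) (hg' : Continuous g') {a b c : ℝ}
    (hb : ∃ σ : Path (g b) (g' b), IsTrack D σ) (h₁ : Transported D g g' a b)
    (h₂ : Transported D g g' b c) : Transported D g g' a c := by
  intro x y x' y' p p' π ρ hp hp' hπ hρ
  obtain ⟨σ, hσ⟩ := hb
  obtain rfl := hp.source
  obtain rfl := hp.target
  obtain rfl := hp'.source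
  obtain rfl := hp'.target
  obtain ⟨q, hq⟩ := IsSegment.exists_path hg a b
  obtain ⟨r, hr⟩ := IsSegment.exists_path hg b c
  obtain ⟨q', hq'⟩ := IsSegment.exists_path hg' a b
  obtain ⟨r', hr'⟩ := IsSegment.exists_path hg' b c
  have e₁ := h₁ q q' π σ hq hq' hπ hσ
  have e₂ := h₂ r r' σ ρ hr hr' hσ hρ
  have e₃ := IsSegment.trans_homotopic hg hq hr hp
  have e₄ := IsSegment.trans_homotopic hg' hq' hr' hp'
  rw [← Path.Homotopic.Quotient.eq] at *
  simp only [Path.Homotopic.Quotient.mk_trans] at *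
  grind

/-- The curve `g'` arises from the curve `g` by replacements of arcs inside of `D`. -/
structure ArcwiseReplaced (D : Set X) (g g' : ℝ → X) : Prop where
  continuous_left : Continuous g
  continuous_right : Continuous g'
  mem_or_eq : ∀ a, (g a ∈ D ∧ g' a ∈ D) ∨ g a = g' a
  locally_compatible : ∀ x, ∀ᶠ y in 𝓝 x, ∃ b, Compatible D g g' x b ∧ Compatible D g g' b y

theorem ArcwiseReplaced.refl {g : ℝ → X} (hg : Continuous g) : ArcwiseReplaced D g g :=
  ⟨hg, hg, fun _ => Or.inr rfl, fun x => Filter.Eventually.of_forall fun _ =>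
    ⟨x, Or.inr fun _ _ => rfl, Or.inr fun _ _ => rfl⟩⟩

theorem ArcwiseReplaced.exists_track (hD : IsSimplyConnected D) {g g' : ℝ → X}
    (h : ArcwiseReplaced D g g') (a : ℝ) : ∃ σ : Path (g a) (g' a), IsTrack D σ := by
  rcases h.mem_or_eq a with ha | ha
  · obtain ⟨σ, hσ⟩ := hD.isPathConnected.joinedIn _ ha.1 _ ha.2
    exact ⟨σ, Or.inl hσ⟩
  · exact ⟨(Path.refl (g a)).cast rfl ha.symm, Or.inr fun _ => rfl⟩

/-- By connectedness of `ℝ`: the parameters reached from `a` form a clopen set. Local transport away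
from a point gives openness, transport back to it gives closedness. -/
theorem ArcwiseReplaced.transported (hD : IsSimplyConnected D) {g g' : ℝ → X}
    (h : ArcwiseReplaced D g g') (a b : ℝ) : Transported D g g' a b := by
  have trans : ∀ {a b c}, Transported D g g' a b → Transported D g g' b c →
      Transported D g g' a c := fun h₁ h₂ =>
    h₁.trans h.continuous_left h.continuous_right (h.exists_track hD _) h₂
  have hloc : ∀ x, ∀ᶠ y in 𝓝 x, Transported D g g' x y ∧ Transported D g g' y x := by
    intro x
    filter_upwards [h.locally_compatible x] with y ⟨b, h₁, h₂⟩
    exact ⟨trans (h₁.transported hD) (h₂.transported hD),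
      trans (h₂.symm.transported hD) (h₁.symm.transported hD)⟩
  have hclopen : IsClopen {y | Transported D g g' a y} := by
    constructor
    · rw [← isOpen_compl_iff, isOpen_iff_mem_nhds]
      intro y hy
      filter_upwards [hloc y] with z hz hz'
      exact hy (trans hz' hz.2)
    · rw [isOpen_iff_mem_nhds]
      intro y hy
      filter_upwards [hloc y] with z hz
      exact trans hy hz.1
  have := hclopen.eq_univ ⟨a, (hloc a).self_of_nhds.1⟩
  exact this.symm.subset (mem_univ b)

/-- Transport over a full period conjugates the old loop into the new one at the same parameter. The
basepoint is then slid from `s` to `s'` along the new curve, which stays in `D` on this stretch. -/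
theorem ArcwiseReplaced.loopFrom_homotopic (hD : IsSimplyConnected D)
    {γ γ' : C(UnitAddCircle, X)}
    (h : ArcwiseReplaced D (fun r : ℝ => γ r) (fun r : ℝ => γ' r)) {s s' : ℝ}
    (δ : Path (γ (s : UnitAddCircle)) (γ' (s' : UnitAddCircle)))
    (hδ : (s = s' ∧ ∀ t, δ t = γ s) ∨ ((∀ z ∈ uIcc s s', γ' (z : UnitAddCircle) ∈ D) ∧
      ∀ t, δ t ∈ D)) :
    ((loopFrom γ (s : UnitAddCircle)).trans δ).Homotopic
      (δ.trans (loopFrom γ' (s' : UnitAddCircle))) := by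
  have hseg := isSegment_loopFrom γ s
  have key : ∀ π : Path (γ (s : UnitAddCircle)) (γ' (s : UnitAddCircle)), IsTrack D π →
      ((loopFrom γ (s : UnitAddCircle)).trans π).Homotopic
        (π.trans (loopFrom γ' (s : UnitAddCircle))) := fun π hπ =>
    h.transported hD s (s + 1) _ _ π π hseg (isSegment_loopFrom γ' s) hπ hπ
  rcases hδ with ⟨rfl, hδ⟩ | ⟨hz, hδ⟩
  · exact key δ (Or.inr hδ)
  obtain ⟨π, hπ⟩ := h.exists_track hD s
  have hs : γ (s : UnitAddCircle) ∈ D := by simpa using hδ 0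
  obtain ⟨σ, hσ⟩ := IsSegment.exists_path h.continuous_right s s'
  have hσD : ∀ t, σ t ∈ D := fun t => by rw [hσ t]; exact hz _ (add_mul_sub_mem_uIcc s s' t)
  have e₁ := key π hπ
  have e₂ : δ.Homotopic (π.trans σ) := hD.homotopic hδ (Path.trans_mem (hπ.mem hs) hσD)
  have hper : ∀ r : ℝ, γ' ((r + 1 : ℝ) : UnitAddCircle) = γ' (r : UnitAddCircle) := fun r => by
    rw [AddCircle.coe_add, AddCircle.coe_period, add_zero]
  -- The segment from `s` to `s' + 1` splits in two ways: a full turn and then `σ` shifted by a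
  -- period, or `σ` and then a full turn. So `σ` conjugates the loops at `s` and `s'`.
  obtain ⟨ν, hν⟩ := IsSegment.exists_path h.continuous_right s (s' + 1)
  let ν' : Path (γ' (s : UnitAddCircle)) (γ' (s' : UnitAddCircle)) := ν.cast rfl (hper s').symm
  have e₃ : ((loopFrom γ' (s : UnitAddCircle)).trans σ).Homotopic ν' :=
    IsSegment.trans_homotopic h.continuous_right (isSegment_loopFrom γ' s)
      (hσ.add_period hper) hν
  have e₄ : (σ.trans (loopFrom γ' (s' : UnitAddCircle))).Homotopic ν' :=
    IsSegment.trans_homotopic h.continuous_right hσ (isSegment_loopFrom γ' s') hν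
  rw [← Path.Homotopic.Quotient.eq] at *
  simp only [Path.Homotopic.Quotient.mk_trans] at *
  grind

end Transport

/-! ### Smoothings of crossings under replacements -/

section ReplacedSmoothing

variable {X : Type*} [TopologicalSpace X] {D : Set X}

/-- A single path `δ` from the old crossing point to the new one serves both strands: the constant
path if the crossing is fixed, an arbitrary path in `D` otherwise. -/
theorem ArcwiseReplaced.ofPath_smoothing_eq (hD : IsSimplyConnected D)
    {γ₀ γ₁ γ₀' γ₁' : C(UnitAddCircle, X)}
    (h₀ : ArcwiseReplaced D (fun r : ℝ => γ₀ r) (fun r : ℝ => γ₀' r))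
    (h₁ : ArcwiseReplaced D (fun r : ℝ => γ₁ r) (fun r : ℝ => γ₁' r)) {s t s' t' : ℝ}
    (h : γ₀ (s : UnitAddCircle) = γ₁ (t : UnitAddCircle))
    (h' : γ₀' (s' : UnitAddCircle) = γ₁' (t' : UnitAddCircle))
    (hst : (s = s' ∧ t = t' ∧ γ₀ (s : UnitAddCircle) = γ₀' (s' : UnitAddCircle)) ∨
      (γ₀ (s : UnitAddCircle) ∈ D ∧ (∀ z ∈ uIcc s s', γ₀' (z : UnitAddCircle) ∈ D) ∧
        ∀ z ∈ uIcc t t', γ₁' (z : UnitAddCircle) ∈ D)) :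
    FreeLoopClass.ofPath ((loopFrom γ₀ s).trans ((loopFrom γ₁ t).cast h h)) =
      FreeLoopClass.ofPath ((loopFrom γ₀' s').trans ((loopFrom γ₁' t').cast h' h')) := by
  rcases hst with ⟨hs, ht, he⟩ | ⟨hmem, hs, ht⟩
  · let δ : Path (γ₀ (s : UnitAddCircle)) (γ₀' (s' : UnitAddCircle)) :=
      (Path.refl _).cast rfl he.symm
    exact FreeLoopClass.ofPath_trans_cast_eq _ _ h _ _ h' δ (δ.cast h.symm h'.symm) (fun _ => rfl)
      (h₀.loopFrom_homotopic hD _ (Or.inl ⟨hs, fun _ => rfl⟩))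
      (h₁.loopFrom_homotopic hD _ (Or.inl ⟨ht, fun _ => h⟩))
  · obtain ⟨δ, hδ⟩ := hD.isPathConnected.joinedIn _ hmem _ (hs s' right_mem_uIcc)
    exact FreeLoopClass.ofPath_trans_cast_eq _ _ h _ _ h' δ (δ.cast h.symm h'.symm) (fun _ => rfl)
      (h₀.loopFrom_homotopic hD _ (Or.inr ⟨hs, hδ⟩))
      (h₁.loopFrom_homotopic hD _ (Or.inr ⟨ht, hδ⟩))

end ReplacedSmoothing

/-! ### Arcs -/

theorem UnitAddCircle.coe_eq_coe_iff {a b : ℝ} :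
    (a : UnitAddCircle) = b ↔ ∃ k : ℤ, a = b + k := by
  rw [← sub_eq_zero, ← AddCircle.coe_sub, AddCircle.coe_eq_zero_iff]
  simp only [zsmul_eq_mul, mul_one]
  exact exists_congr fun k => ⟨fun h => by linarith, fun h => by linarith⟩

namespace Arc

variable {n : ℕ}

theorem continuous_pt (e : Arc n) : Continuous e.pt := by
  unfold Arc.pt
  exact continuous_const.prodMk ((AddCircle.continuous_mk' 1).comp (by fun_prop))

theorem exists_of_mem_uIcc (e : Arc n) (m : ℝ) {s t z : ℝ}
    (hz : z ∈ uIcc (m + s * e.half) (m + t * e.half)) :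
    ∃ r ∈ uIcc s t, z = m + r * e.half := by
  rw [← segment_eq_uIcc] at hz
  obtain ⟨α, β, hα, hβ, hαβ, rfl⟩ := hz
  refine ⟨α * s + β * t, ?_, ?_⟩
  · rw [← segment_eq_uIcc]; exact ⟨α, β, hα, hβ, hαβ, rfl⟩
  · simp only [smul_eq_mul]
    linear_combination m * hαβ

/-- Near a point of an arc, the arc is an interval in terms of its coordinate. -/
theorem mem_Icc_of_pt_eq (e : Arc n) {m s t r : ℝ} (k : ℤ) (hm : m = e.mid + k)
    (hs : s ∈ Icc (-1 : ℝ) 1) (hr : r ∈ Icc (-1 : ℝ) 1)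
    (hlt : |(m + t * e.half) - (m + s * e.half)| < 1 - 2 * |e.half|)
    (h : e.pt r = (e.comp, ((m + t * e.half : ℝ) : UnitAddCircle))) : t ∈ Icc (-1 : ℝ) 1 := by
  have h1 := (Prod.ext_iff.1 h).2
  simp only [Arc.pt] at h1
  obtain ⟨l, hl⟩ := UnitAddCircle.coe_eq_coe_iff.1 h1
  -- The number of turns `k + l` separating the two lifts has absolute value less than `2 * |e.half|
  -- + (1 - 2 * |e.half|) = 1`, so it vanishes.
  have h2 : ((k + l : ℤ) : ℝ) = (r - s) * e.half - ((m + t * e.half) - (m + s * e.half)) := by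
    push_cast; rw [hm] at hl ⊢; linear_combination -hl
  have h3 : |(r - s) * e.half| ≤ 2 * |e.half| := by
    rw [abs_mul]
    refine mul_le_mul_of_nonneg_right ?_ (abs_nonneg _)
    rw [abs_le]; constructor <;> linarith [hs.1, hs.2, hr.1, hr.2]
  have h4 : |((k + l : ℤ) : ℝ)| < 1 := by
    rw [h2]
    exact (abs_sub _ _).trans_lt (by linarith)
  have h5 : k + l = 0 := by
    have : |k + l| < 1 := by exact_mod_cast h4
    exact Int.abs_lt_one_iff.1 this
  have h6 : (r - t) * e.half = 0 := by
    rw [h5] at h2; push_cast at h2; linear_combination -h2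
  rcases mul_eq_zero.1 h6 with h7 | h7
  · rwa [← sub_eq_zero.1 h7]
  · exact absurd h7 e.half_ne

end Arc

theorem isClosed_arcsSupport {n k : ℕ} (e : Fin k → Arc n) : IsClosed (arcsSupport e) := by
  have : arcsSupport e = ⋃ i, (e i).pt '' Icc (-1 : ℝ) 1 := by
    ext p; simp [arcsSupport]
  rw [this]
  exact isClosed_iUnion_of_finite fun i => (isCompact_Icc.image (e i).continuous_pt).isClosed

namespace Replaces

variable {X : Type*} [TopologicalSpace X] {n k : ℕ} {L L' : OrientedLink X n} {D : Set X}
  {e : Fin k → Arc n} {u u' : Fin k → ℝ → X}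

/-- On the arcs both curves lie in `D`, off the arcs they coincide. The delicate points are the ends
of arcs, where agreement of the endpoints lets the two regimes meet. -/
theorem arcwiseReplaced (h : Replaces L L' D e u u') (hl : ∀ i, u' i (-1) = u i (-1))
    (hr : ∀ i, u' i 1 = u i 1) (c : Fin n) :
    ArcwiseReplaced D (fun r : ℝ => L.curve c r) (fun r : ℝ => L'.curve c r) := by
  have hcoe : Continuous fun r : ℝ => (r : UnitAddCircle) := AddCircle.continuous_mk' 1
  have hmem : ∀ z : ℝ, (c, (z : UnitAddCircle)) ∈ arcsSupport e →
      L.curve c z ∈ D ∧ L'.curve c z ∈ D := fun z hz =>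
    ⟨(h.before_mem (c, (z : UnitAddCircle))).2 hz, (h.after_mem (c, (z : UnitAddCircle))).2 hz⟩
  have heq : ∀ z : ℝ, (c, (z : UnitAddCircle)) ∉ arcsSupport e →
      L.curve c z = L'.curve c z := fun z hz => (h.pt_eq _ hz).symm
  refine ⟨(L.curve c).continuous.comp hcoe, (L'.curve c).continuous.comp hcoe, fun a => ?_,
    fun x => ?_⟩
  · by_cases ha : (c, (a : UnitAddCircle)) ∈ arcsSupport e
    · exact Or.inl (hmem a ha)
    · exact Or.inr (heq a ha)
  by_cases hx : (c, (x : UnitAddCircle)) ∈ arcsSupport e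
  swap
  · have hopen : IsOpen {z : ℝ | (c, (z : UnitAddCircle)) ∉ arcsSupport e} :=
      (isClosed_arcsSupport e).isOpen_compl.preimage (continuous_const.prodMk hcoe)
    obtain ⟨ε, hε, hball⟩ := Metric.isOpen_iff.1 hopen x hx
    filter_upwards [Metric.ball_mem_nhds x hε] with y hy
    refine ⟨y, Or.inr fun z hz => heq z (hball ?_), Or.inr fun z hz => heq z (hball ?_)⟩
    · exact (Real.ball_eq_Ioo x ε ▸ ordConnected_Ioo : (Metric.ball x ε).OrdConnected).uIcc_subset
        (Metric.mem_ball_self hε) hy hz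
    · rw [uIcc_self, mem_singleton_iff] at hz; rwa [hz]
  obtain ⟨i, s, hs, hi⟩ := hx
  have hc : (e i).comp = c := congrArg Prod.fst hi
  obtain ⟨l, hl'⟩ := UnitAddCircle.coe_eq_coe_iff.1 (congrArg Prod.snd hi).symm
  -- The lift of the midpoint of the arc for which the real number `x` has coordinate `s`.
  set m : ℝ := (e i).mid + l with hm
  have hxm : x = m + s * (e i).half := by rw [hl', hm]; ring
  have hpt : ∀ r : ℝ, (c, ((m + r * (e i).half : ℝ) : UnitAddCircle)) = (e i).pt r := by
    intro r
    refine Prod.ext hc.symm ?_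
    exact UnitAddCircle.coe_eq_coe_iff.2 ⟨l, by rw [hm]; ring⟩
  have hsupp : ∀ r ∈ Icc (-1 : ℝ) 1,
      (c, ((m + r * (e i).half : ℝ) : UnitAddCircle)) ∈ arcsSupport e := fun r hr =>
    ⟨i, r, hr, (hpt r).symm⟩
  have hends : ∀ r : ℝ, r = -1 ∨ r = 1 →
      L.curve c ((m + r * (e i).half : ℝ) : UnitAddCircle) =
        L'.curve c ((m + r * (e i).half : ℝ) : UnitAddCircle) := by
    intro r hr'
    have hr1 : r ∈ Icc (-1 : ℝ) 1 := by rcases hr' with rfl | rfl <;> simp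
    have e1 := h.before i r hr1
    have e2 := h.after i r hr1
    rw [← hpt] at e1 e2
    refine e1.trans (Eq.trans ?_ e2.symm)
    rcases hr' with rfl | rfl
    · exact (hl i).symm
    · exact (hr i).symm
  let e' : {j // j ≠ i} → Set (Circles n) := fun j => (e j).pt '' Icc (-1 : ℝ) 1
  have hopen : IsOpen {z : ℝ | (c, (z : UnitAddCircle)) ∉ ⋃ j, e' j} :=
    (isClosed_iUnion_of_finite fun j : {j // j ≠ i} =>
      (isCompact_Icc.image (e j).continuous_pt).isClosed).isOpen_compl.preimage
        (continuous_const.prodMk hcoe)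
  have hxo : (c, (x : UnitAddCircle)) ∉ ⋃ j, e' j := by
    rw [mem_iUnion]
    rintro ⟨⟨j, hj⟩, t, ht, hjt⟩
    exact hj (h.disjoint j i t ht s hs (hjt.trans hi.symm)).1
  obtain ⟨ε, hε, hball⟩ := Metric.isOpen_iff.1 hopen x hxo
  have hhalf : 0 < 1 - 2 * |(e i).half| := by linarith [(e i).half_lt]
  -- Within `ε` no other arc is met; within `1 - 2 * |(e i).half|` the arc `e i` cannot be met again
  -- after a turn around the circle.
  set η := min ε (1 - 2 * |(e i).half|)
  have hη : 0 < η := lt_min hε hhalf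
  have hout : ∀ r : ℝ, m + r * (e i).half ∈ Metric.ball x η → r ∉ Icc (-1 : ℝ) 1 →
      (c, ((m + r * (e i).half : ℝ) : UnitAddCircle)) ∉ arcsSupport e := by
    rintro r hr hr1 ⟨j, t, ht, hjt⟩
    by_cases hji : j = i
    · subst hji
      refine hr1 ((e j).mem_Icc_of_pt_eq l hm hs ht ?_ (hc ▸ hjt))
      have := (Metric.mem_ball.1 hr).trans_le (min_le_right _ _)
      rwa [Real.dist_eq, hxm] at this
    · exact hball (Metric.ball_subset_ball (min_le_left _ _) hr)
        (mem_iUnion.2 ⟨⟨j, hji⟩, t, ht, hjt⟩)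
  have hord : (Metric.ball x η).OrdConnected := Real.ball_eq_Ioo x η ▸ ordConnected_Ioo
  filter_upwards [Metric.ball_mem_nhds x hη] with y hy
  obtain ⟨t, rfl⟩ : ∃ t, y = m + t * (e i).half :=
    ⟨(y - m) / (e i).half, by field_simp [(e i).half_ne]; ring⟩
  have hin : ∀ r ∈ Icc (-1 : ℝ) 1,
      Compatible D (fun r : ℝ => L.curve c r) (fun r : ℝ => L'.curve c r) x
        (m + r * (e i).half) := by
    intro r hr
    refine Or.inl fun z hz => ?_
    rw [hxm] at hz
    obtain ⟨w, hw, rfl⟩ := (e i).exists_of_mem_uIcc m hz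
    exact hmem _ (hsupp w (ordConnected_Icc.uIcc_subset hs hr hw))
  have hbeyond : ∀ r : ℝ, r = -1 ∨ r = 1 → r ∈ uIcc s t →
      (∀ w ∈ uIcc r t, w ≠ r → w ∉ Icc (-1 : ℝ) 1) →
      Compatible D (fun r : ℝ => L.curve c r) (fun r : ℝ => L'.curve c r) (m + r * (e i).half)
        (m + t * (e i).half) := by
    intro r hr hrt hw'
    refine Or.inr fun z hz => ?_
    obtain ⟨w, hw, rfl⟩ := (e i).exists_of_mem_uIcc m hz
    by_cases hwr : w = r
    · rw [hwr]; exact hends r hr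
    · refine heq _ (hout w ?_ (hw' w hw hwr))
      refine hord.uIcc_subset (Metric.mem_ball_self hη) hy ?_
      rw [hxm]
      have hwst : w ∈ uIcc s t := uIcc_subset_uIcc_right hrt hw
      rw [← segment_eq_uIcc] at hwst ⊢
      obtain ⟨α, β, hα, hβ, hαβ, rfl⟩ := hwst
      refine ⟨α, β, hα, hβ, hαβ, ?_⟩
      simp only [smul_eq_mul]
      linear_combination m * hαβ
  -- If `y` lies beyond an end of the arc, that end is the intermediate parameter: up to it both
  -- curves run in `D`, after it they coincide. If `y` is still on the arc, `y` itself is taken.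
  rcases lt_or_ge t (-1) with h1 | h1
  · refine ⟨m + (-1) * (e i).half, hin (-1) (by simp), hbeyond (-1) (Or.inl rfl) ?_ ?_⟩
    · rw [uIcc_of_ge (by linarith [hs.1])]; exact ⟨h1.le, hs.1⟩
    · intro w hw hne
      rw [uIcc_of_ge h1.le] at hw
      exact fun hw' => hne (le_antisymm hw.2 hw'.1)
  rcases lt_or_ge 1 t with h2 | h2
  · refine ⟨m + 1 * (e i).half, hin 1 (by simp), hbeyond 1 (Or.inr rfl) ?_ ?_⟩
    · rw [uIcc_of_le (by linarith [hs.2])]; exact ⟨hs.2, h2.le⟩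
    · intro w hw hne
      rw [uIcc_of_le h2.le] at hw
      exact fun hw' => hne (le_antisymm hw'.2 hw.1)
  · refine ⟨_, hin t ⟨h1, h2⟩, Or.inl fun z hz => ?_⟩
    rw [uIcc_self, mem_singleton_iff] at hz
    rw [hz]
    exact hmem _ (hsupp t ⟨h1, h2⟩)

end Replaces

/-! ### Crossings under replacements -/

section Reflection

variable {n k : ℕ} {e : Fin k → Arc n}

open Classical in
/-- The reflection of all arcs of a family in their midpoints. -/
noncomputable def reflectArcs (e : Fin k → Arc n) (p : Circles n) : Circles n :=
  if h : p ∈ arcsSupport e then (e h.choose).pt (-h.choose_spec.choose) else p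

theorem reflectArcs_of_notMem {p : Circles n} (h : p ∉ arcsSupport e) : reflectArcs e p = p :=
  dif_neg h

/-- Disjointness and injectivity of the arcs force the chosen index and coordinate to be the given
ones. -/
theorem reflectArcs_pt (hdisj : ∀ i j, ∀ s ∈ Icc (-1 : ℝ) 1, ∀ t ∈ Icc (-1 : ℝ) 1,
    (e i).pt s = (e j).pt t → i = j ∧ s = t) (i : Fin k) {s : ℝ} (hs : s ∈ Icc (-1 : ℝ) 1) :
    reflectArcs e ((e i).pt s) = (e i).pt (-s) := by
  have h : (e i).pt s ∈ arcsSupport e := ⟨i, s, hs, rfl⟩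
  rw [reflectArcs, dif_pos h]
  have h2 := h.choose_spec.choose_spec
  obtain ⟨h3, h4⟩ := hdisj _ _ _ h2.1 s hs h2.2
  rw [h4, h3]

theorem neg_mem_Icc_neg_one_one {s : ℝ} (hs : s ∈ Icc (-1 : ℝ) 1) : -s ∈ Icc (-1 : ℝ) 1 :=
  ⟨by linarith [hs.2], by linarith [hs.1]⟩

theorem reflectArcs_fst (p : Circles n) : (reflectArcs e p).1 = p.1 := by
  by_cases h : p ∈ arcsSupport e
  · rw [reflectArcs, dif_pos h]
    exact (Prod.ext_iff.1 h.choose_spec.choose_spec.2).1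
  · rw [reflectArcs_of_notMem h]

theorem reflectArcs_involutive (hdisj : ∀ i j, ∀ s ∈ Icc (-1 : ℝ) 1, ∀ t ∈ Icc (-1 : ℝ) 1,
    (e i).pt s = (e j).pt t → i = j ∧ s = t) : Function.Involutive (reflectArcs e) := by
  intro p
  by_cases h : p ∈ arcsSupport e
  · obtain ⟨i, s, hs, rfl⟩ := h
    rw [reflectArcs_pt hdisj i hs, reflectArcs_pt hdisj i (neg_mem_Icc_neg_one_one hs), neg_neg]
  · rw [reflectArcs_of_notMem h, reflectArcs_of_notMem h]

theorem reflectArcs_mem {p : Circles n} (h : p ∈ arcsSupport e) :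
    reflectArcs e p ∈ arcsSupport e := by
  rw [reflectArcs, dif_pos h]
  exact ⟨_, _, neg_mem_Icc_neg_one_one h.choose_spec.choose_spec.1, rfl⟩

end Reflection

/-! ### Terms and signs of single crossings -/

namespace OrientedLink

variable {X : Type*} [TopologicalSpace X]

/-- The contribution of a crossing to the linking class. -/
noncomputable def crossingTerm (L : OrientedLink X 2) (c : L.InterCrossing) :
    FreeLoopClass X →₀ ℤ :=
  Finsupp.single (FreeLoopClass.ofPath (L.smoothing c)) (L.crossingSign c)

theorem LK_eq_sum (L : OrientedLink X 2) : L.LK = ∑ c, L.crossingTerm c := rfl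

/-- One of the four areas determines the others: passing to the opposite area preserves the dot,
passing to an adjacent one negates it. -/
theorem dots_iff {n : ℕ} (L : OrientedLink X n) {p q : Circles n} (hne : p ≠ q)
    (hpq : L.pt p = L.pt q) (a b : Bool) :
    L.dots (p, a) (q, b) ↔ (a = b ↔ L.dots (p, true) (q, true)) := by
  have h1 : ∀ a b, L.dots (p, !a) (q, !b) ↔ L.dots (p, a) (q, b) := fun a b =>
    ⟨fun h => by simpa using L.dots_opposite _ _ _ _ h, L.dots_opposite _ _ _ _⟩
  have h2 := h1 true true
  have h3 := h1 true false
  have h4 := L.dots_adjacent p q true true hne hpq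
  simp only [Bool.not_true, Bool.not_false] at h2 h3 h4
  cases a <;> cases b <;> simp <;> tauto

theorem sign_congr {n : ℕ} {L L' : OrientedLink X n} {p q p' q' : Circles n}
    (h : L.dots (p, true) (q, true) ↔ L'.dots (p', true) (q', true)) :
    L.sign p q = L'.sign p' q' := by
  unfold sign
  split_ifs <;> tauto

theorem sign_comm {n : ℕ} (L : OrientedLink X n) (p q : Circles n) : L.sign p q = L.sign q p :=
  sign_congr ⟨L.dots_symm _ _, L.dots_symm _ _⟩

theorem sign_ne_zero {n : ℕ} (L : OrientedLink X n) (p q : Circles n) : L.sign p q ≠ 0 := by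
  unfold sign; split_ifs <;> simp

end OrientedLink

namespace Replaces

variable {X : Type*} [TopologicalSpace X] {n k : ℕ}

section

variable {L L' : OrientedLink X n} {D : Set X} {e : Fin k → Arc n} {u u' : Fin k → ℝ → X}

theorem symm (h : Replaces L L' D e u u') : Replaces L' L D e u' u :=
  ⟨h.disjoint, h.after, h.before, h.after_mem, h.before_mem, fun p hp => (h.pt_eq p hp).symm,
    fun a b ha hb => (h.dots_iff a b ha hb).symm⟩

/-- Regarding `L'` as a replacement of itself turns the reflection of the arcs into an involution of
its own crossings, as needed for cancellation in pairs. -/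
theorem self_right (h : Replaces L L' D e u u') : Replaces L' L' D e u' u' :=
  ⟨h.disjoint, h.after, h.after, h.after_mem, h.after_mem, fun _ _ => rfl,
    fun _ _ _ _ => Iff.rfl⟩

theorem mem_iff_mem (h : Replaces L L' D e u u') {p q : Circles n} (hpq : L.pt p = L.pt q) :
    p ∈ arcsSupport e ↔ q ∈ arcsSupport e := by
  rw [← h.before_mem, ← h.before_mem, hpq]

/-- A crossing inside of `D` of two different components is a crossing of two different arcs. -/
theorem exists_arcs (h : Replaces L L' D e u u') {p q : Circles n} (hne : p.1 ≠ q.1)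
    (hpq : L.pt p = L.pt q) (hp : p ∈ arcsSupport e) :
    ∃ i j, i ≠ j ∧ ∃ s ∈ Icc (-1 : ℝ) 1, ∃ t ∈ Icc (-1 : ℝ) 1,
      p = (e i).pt s ∧ q = (e j).pt t ∧ u i s = u j t := by
  have hq := (h.mem_iff_mem hpq).1 hp
  obtain ⟨i, s, hs, rfl⟩ := hp
  obtain ⟨j, t, ht, rfl⟩ := hq
  refine ⟨i, j, ?_, s, hs, t, ht, rfl, rfl, ?_⟩
  · rintro rfl
    exact hne rfl
  · rw [← h.before i s hs, ← h.before j t ht, hpq]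

theorem pt_reflectArcs_eq (h : Replaces L L' D e u u')
    (hcross : ∀ i j, i ≠ j → ∀ s ∈ Icc (-1 : ℝ) 1, ∀ t ∈ Icc (-1 : ℝ) 1, u i s = u j t →
      u' i (-s) = u' j (-t)) {p q : Circles n} (hne : p.1 ≠ q.1) (hpq : L.pt p = L.pt q) :
    L'.pt (reflectArcs e p) = L'.pt (reflectArcs e q) := by
  by_cases hp : p ∈ arcsSupport e
  · obtain ⟨i, j, hij, s, hs, t, ht, rfl, rfl, huu⟩ := h.exists_arcs hne hpq hp
    rw [reflectArcs_pt h.disjoint i hs, reflectArcs_pt h.disjoint j ht,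
      h.after i _ (neg_mem_Icc_neg_one_one hs), h.after j _ (neg_mem_Icc_neg_one_one ht)]
    exact hcross i j hij s hs t ht huu
  · have hq := mt (h.mem_iff_mem hpq).2 hp
    rw [reflectArcs_of_notMem hp, reflectArcs_of_notMem hq, h.pt_eq p hp, h.pt_eq q hq, hpq]

end

variable {L L' : OrientedLink X 2} {D : Set X} {e : Fin k → Arc 2} {u u' : Fin k → ℝ → X}

/-- The crossing of `L'` which corresponds to a crossing of `L` under the reflection of the
arcs. -/
noncomputable def mapCrossing (h : Replaces L L' D e u u')
    (hcross : ∀ i j, i ≠ j → ∀ s ∈ Icc (-1 : ℝ) 1, ∀ t ∈ Icc (-1 : ℝ) 1, u i s = u j t →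
      u' i (-s) = u' j (-t)) (c : L.InterCrossing) : L'.InterCrossing :=
  ⟨((reflectArcs e (0, c.1.1)).2, (reflectArcs e (1, c.1.2)).2), by
    have h1 := h.pt_reflectArcs_eq hcross (p := (0, c.1.1)) (q := (1, c.1.2))
      (show (0 : Fin 2) ≠ 1 by decide) c.2
    have h2 : reflectArcs e (0, c.1.1) = (0, (reflectArcs e (0, c.1.1)).2) :=
      Prod.ext (reflectArcs_fst _) rfl
    have h3 : reflectArcs e (1, c.1.2) = (1, (reflectArcs e (1, c.1.2)).2) :=
      Prod.ext (reflectArcs_fst _) rfl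
    rw [h2, h3] at h1
    exact h1⟩

variable {hcross : ∀ i j, i ≠ j → ∀ s ∈ Icc (-1 : ℝ) 1, ∀ t ∈ Icc (-1 : ℝ) 1, u i s = u j t →
      u' i (-s) = u' j (-t)}

theorem mapCrossing_fst (h : Replaces L L' D e u u') (c : L.InterCrossing) :
    ((0, (h.mapCrossing hcross c).1.1) : Circles 2) = reflectArcs e (0, c.1.1) :=
  Prod.ext (reflectArcs_fst (e := e) (0, c.1.1)).symm rfl

theorem mapCrossing_snd (h : Replaces L L' D e u u') (c : L.InterCrossing) :
    ((1, (h.mapCrossing hcross c).1.2) : Circles 2) = reflectArcs e (1, c.1.2) :=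
  Prod.ext (reflectArcs_fst (e := e) (1, c.1.2)).symm rfl

/-- The reflection is involutive. The third link is arbitrary in order to cover both the way back to
`L` and the iteration of a self-replacement. -/
theorem mapCrossing_mapCrossing (h : Replaces L L' D e u u') {L'' : OrientedLink X 2}
    {v : Fin k → ℝ → X} (h' : Replaces L' L'' D e u' v)
    {hcross' : ∀ i j, i ≠ j → ∀ s ∈ Icc (-1 : ℝ) 1, ∀ t ∈ Icc (-1 : ℝ) 1, u' i s = u' j t →
      v i (-s) = v j (-t)} (c : L.InterCrossing) :
    (h'.mapCrossing hcross' (h.mapCrossing hcross c)).1 = c.1 := by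
  have h1 := h'.mapCrossing_fst (hcross := hcross') (h.mapCrossing hcross c)
  have h2 := h'.mapCrossing_snd (hcross := hcross') (h.mapCrossing hcross c)
  rw [h.mapCrossing_fst, reflectArcs_involutive h.disjoint] at h1
  rw [h.mapCrossing_snd, reflectArcs_involutive h.disjoint] at h2
  exact Prod.ext (Prod.ext_iff.1 h1).2 (Prod.ext_iff.1 h2).2

theorem exists_arcs_of_crossing (h : Replaces L L' D e u u') (c : L.InterCrossing)
    (hc : ((0, c.1.1) : Circles 2) ∈ arcsSupport e) :
    ∃ i j, i ≠ j ∧ ∃ s ∈ Icc (-1 : ℝ) 1, ∃ t ∈ Icc (-1 : ℝ) 1,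
      (0, c.1.1) = (e i).pt s ∧ (1, c.1.2) = (e j).pt t ∧ u i s = u j t :=
  h.exists_arcs (p := (0, c.1.1)) (q := (1, c.1.2)) (show (0 : Fin 2) ≠ 1 by decide) c.2 hc

theorem notMem_of_crossing (h : Replaces L L' D e u u') (c : L.InterCrossing)
    (hc : ((0, c.1.1) : Circles 2) ∉ arcsSupport e) :
    ((1, c.1.2) : Circles 2) ∉ arcsSupport e :=
  mt (h.mem_iff_mem (p := (0, c.1.1)) (q := (1, c.1.2)) c.2).2 hc

/-- Between the coordinates `s` and `-s` an arc stays in `D`, so a reflected crossing is an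
admissible displacement of the basepoint; crossings off the arcs do not move. -/
theorem ofPath_smoothing_mapCrossing (h : Replaces L L' D e u u') (hD : IsSimplyConnected D)
    (hl : ∀ i, u' i (-1) = u i (-1)) (hr : ∀ i, u' i 1 = u i 1) (c : L.InterCrossing) :
    FreeLoopClass.ofPath (L'.smoothing (h.mapCrossing hcross c)) =
      FreeLoopClass.ofPath (L.smoothing c) := by
  have h0 := h.mapCrossing_fst (hcross := hcross) c
  have h1 := h.mapCrossing_snd (hcross := hcross) c
  generalize h.mapCrossing hcross c = c' at h0 h1 ⊢
  have a0 := h.arcwiseReplaced hl hr 0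
  have a1 := h.arcwiseReplaced hl hr 1
  by_cases hc : ((0, c.1.1) : Circles 2) ∈ arcsSupport e
  · obtain ⟨i, j, hij, s, hs, t, ht, hp, hq, -⟩ := h.exists_arcs_of_crossing c hc
    have hmem : L.curve 0 c.1.1 ∈ D := (h.before_mem (0, c.1.1)).2 hc
    rw [hp, reflectArcs_pt h.disjoint i hs] at h0
    rw [hq, reflectArcs_pt h.disjoint j ht] at h1
    obtain ⟨⟨x, y⟩, hxy⟩ := c
    obtain ⟨⟨x', y'⟩, hxy'⟩ := c'
    obtain rfl : x = _ := congrArg Prod.snd hp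
    obtain rfl : y = _ := congrArg Prod.snd hq
    obtain rfl : x' = _ := congrArg Prod.snd h0
    obtain rfl : y' = _ := congrArg Prod.snd h1
    have hi : (0 : Fin 2) = (e i).comp := congrArg Prod.fst hp
    have hj : (1 : Fin 2) = (e j).comp := congrArg Prod.fst hq
    refine (a0.ofPath_smoothing_eq hD a1 hxy hxy'
      (Or.inr ⟨hmem, fun z hz => ?_, fun z hz => ?_⟩)).symm
    · obtain ⟨r, hr, rfl⟩ := (e i).exists_of_mem_uIcc _ hz
      refine (h.after_mem (0, _)).2 ⟨i, r, ?_, Prod.ext hi.symm rfl⟩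
      exact ordConnected_Icc.uIcc_subset hs (neg_mem_Icc_neg_one_one hs) hr
    · obtain ⟨r, hr, rfl⟩ := (e j).exists_of_mem_uIcc _ hz
      refine (h.after_mem (1, _)).2 ⟨j, r, ?_, Prod.ext hj.symm rfl⟩
      exact ordConnected_Icc.uIcc_subset ht (neg_mem_Icc_neg_one_one ht) hr
  · rw [reflectArcs_of_notMem hc] at h0
    rw [reflectArcs_of_notMem (h.notMem_of_crossing c hc)] at h1
    have hpt : L'.curve 0 c.1.1 = L.curve 0 c.1.1 := h.pt_eq _ hc
    obtain ⟨⟨x, y⟩, hxy⟩ := c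
    obtain ⟨⟨x', y'⟩, hxy'⟩ := c'
    obtain rfl : x' = x := congrArg Prod.snd h0
    obtain rfl : y' = y := congrArg Prod.snd h1
    obtain ⟨x, rfl⟩ := UnitAddCircle.exists_coe_unitInterval x'
    obtain ⟨y, rfl⟩ := UnitAddCircle.exists_coe_unitInterval y'
    exact (a0.ofPath_smoothing_eq hD a1 hxy hxy' (Or.inl ⟨rfl, rfl, hpt.symm⟩)).symm

theorem crossingSign_mapCrossing_of_notMem (h : Replaces L L' D e u u') (c : L.InterCrossing)
    (hc : ((0, c.1.1) : Circles 2) ∉ arcsSupport e) :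
    L'.crossingSign (h.mapCrossing hcross c) = L.crossingSign c := by
  have h1 := h.notMem_of_crossing c hc
  simp only [OrientedLink.crossingSign]
  rw [h.mapCrossing_fst, h.mapCrossing_snd, reflectArcs_of_notMem hc, reflectArcs_of_notMem h1]
  exact OrientedLink.sign_congr (h.dots_iff ((0, c.1.1), true) ((1, c.1.2), true) hc h1)

theorem crossingSign_mapCrossing_of_mem (h : Replaces L L' D e u u') (ε : ℤ)
    (hsign : ∀ i j, i ≠ j → ∀ s ∈ Icc (-1 : ℝ) 1, ∀ t ∈ Icc (-1 : ℝ) 1, u i s = u j t →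
      L'.sign ((e i).pt (-s)) ((e j).pt (-t)) = ε * L.sign ((e i).pt s) ((e j).pt t))
    (c : L.InterCrossing) (hc : ((0, c.1.1) : Circles 2) ∈ arcsSupport e) :
    L'.crossingSign (h.mapCrossing hcross c) = ε * L.crossingSign c := by
  obtain ⟨i, j, hij, s, hs, t, ht, hp, hq, huu⟩ := h.exists_arcs_of_crossing c hc
  simp only [OrientedLink.crossingSign]
  rw [h.mapCrossing_fst, h.mapCrossing_snd, hp, hq, reflectArcs_pt h.disjoint i hs,
    reflectArcs_pt h.disjoint j ht]
  exact hsign i j hij s hs t ht huu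

/-- The linking class does not change if the crossings in `D` are carried along. -/
theorem LK_eq (h : Replaces L L' D e u u') (hD : IsSimplyConnected D)
    (hl : ∀ i, u' i (-1) = u i (-1)) (hr : ∀ i, u' i 1 = u i 1)
    (hcross : ∀ i j, i ≠ j → ∀ s ∈ Icc (-1 : ℝ) 1, ∀ t ∈ Icc (-1 : ℝ) 1, u i s = u j t →
      u' i (-s) = u' j (-t))
    (hcross' : ∀ i j, i ≠ j → ∀ s ∈ Icc (-1 : ℝ) 1, ∀ t ∈ Icc (-1 : ℝ) 1, u' i s = u' j t →
      u i (-s) = u j (-t))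
    (hsign : ∀ i j, i ≠ j → ∀ s ∈ Icc (-1 : ℝ) 1, ∀ t ∈ Icc (-1 : ℝ) 1, u i s = u j t →
      L'.sign ((e i).pt (-s)) ((e j).pt (-t)) = L.sign ((e i).pt s) ((e j).pt t)) :
    L.LK = L'.LK := by
  rw [L.LK_eq_sum, L'.LK_eq_sum]
  refine Finset.sum_bij' (fun c _ => h.mapCrossing hcross c)
    (fun c _ => h.symm.mapCrossing hcross' c) (fun _ _ => Finset.mem_univ _)
    (fun _ _ => Finset.mem_univ _) (fun c _ => Subtype.ext (h.mapCrossing_mapCrossing h.symm c))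
    (fun c _ => Subtype.ext (h.symm.mapCrossing_mapCrossing h c)) fun c _ => ?_
  rw [OrientedLink.crossingTerm, OrientedLink.crossingTerm,
    h.ofPath_smoothing_mapCrossing hD hl hr]
  congr 1
  by_cases hc : ((0, c.1.1) : Circles 2) ∈ arcsSupport e
  · rw [h.crossingSign_mapCrossing_of_mem 1 (by simpa using hsign) c hc, one_mul]
  · exact (h.crossingSign_mapCrossing_of_notMem c hc).symm

/-- The linking class does not change if pairs of crossings with opposite signs are created
in `D`. -/
theorem LK_eq_of_cancel (h : Replaces L L' D e u u') (hD : IsSimplyConnected D)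
    (hl : ∀ i, u' i (-1) = u i (-1)) (hr : ∀ i, u' i 1 = u i 1)
    (hcross : ∀ i j, i ≠ j → ∀ s ∈ Icc (-1 : ℝ) 1, ∀ t ∈ Icc (-1 : ℝ) 1, u i s ≠ u j t)
    (hcross' : ∀ i j, i ≠ j → ∀ s ∈ Icc (-1 : ℝ) 1, ∀ t ∈ Icc (-1 : ℝ) 1, u' i s = u' j t →
      u' i (-s) = u' j (-t))
    (hsign : ∀ i j, i ≠ j → ∀ s ∈ Icc (-1 : ℝ) 1, ∀ t ∈ Icc (-1 : ℝ) 1, u' i s = u' j t →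
      L'.sign ((e i).pt (-s)) ((e j).pt (-t)) = -1 * L'.sign ((e i).pt s) ((e j).pt t)) :
    L.LK = L'.LK := by
  classical
  have hout : ∀ c : L.InterCrossing, ((0, c.1.1) : Circles 2) ∉ arcsSupport e := fun c hc => by
    obtain ⟨i, j, hij, s, hs, t, ht, -, -, huu⟩ := h.exists_arcs_of_crossing c hc
    exact hcross i j hij s hs t ht huu
  -- Vacuous, since no two arcs of `L` meet; every crossing of `L` lies off the arcs and keeps its
  -- parameters.
  have hcross₀ : ∀ i j, i ≠ j → ∀ s ∈ Icc (-1 : ℝ) 1, ∀ t ∈ Icc (-1 : ℝ) 1, u i s = u j t →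
      u' i (-s) = u' j (-t) := fun i j hij s hs t ht huu =>
    absurd huu (hcross i j hij s hs t ht)
  have hself := h.self_right
  rw [L.LK_eq_sum, L'.LK_eq_sum, ← Finset.sum_filter_add_sum_filter_not Finset.univ
    fun c : L'.InterCrossing => ((0, c.1.1) : Circles 2) ∉ arcsSupport e]
  have hin : ∑ c : L'.InterCrossing with ¬ ((0, c.1.1) : Circles 2) ∉ arcsSupport e,
      L'.crossingTerm c = 0 := by
    have hneg : ∀ c : L'.InterCrossing, ((0, c.1.1) : Circles 2) ∈ arcsSupport e →
        L'.crossingSign (hself.mapCrossing hcross' c) = -L'.crossingSign c := fun c hc => by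
      rw [hself.crossingSign_mapCrossing_of_mem (-1) hsign c hc, neg_one_mul]
    -- Reflected crossings in `D` have the same class and opposite signs. None is fixed, because its
    -- sign would equal its own negative and signs are nonzero.
    refine Finset.sum_involution (fun c _ => hself.mapCrossing hcross' c) (fun c hc => ?_)
      (fun c hc _ heq => ?_) (fun c hc => ?_)
      fun c _ => Subtype.ext (hself.mapCrossing_mapCrossing hself c)
    · have hc' := not_not.1 (Finset.mem_filter.1 hc).2
      rw [OrientedLink.crossingTerm, OrientedLink.crossingTerm, hneg c hc',
        hself.ofPath_smoothing_mapCrossing hD (fun _ => rfl) (fun _ => rfl), ← Finsupp.single_add,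
        add_neg_cancel, Finsupp.single_zero]
    · have hc' := not_not.1 (Finset.mem_filter.1 hc).2
      have h1 := hneg c hc'
      rw [heq] at h1
      have h2 : L'.crossingSign c ≠ 0 := L'.sign_ne_zero _ _
      omega
    · have hc' := not_not.1 (Finset.mem_filter.1 hc).2
      refine Finset.mem_filter.2 ⟨Finset.mem_univ _, not_not.2 ?_⟩
      rw [hself.mapCrossing_fst]
      exact reflectArcs_mem hc'
  rw [hin, add_zero]
  refine Finset.sum_bij (fun c _ => h.mapCrossing hcross₀ c) (fun c _ => ?_)
    (fun c _ c' _ hcc => ?_) (fun c hc => ?_) fun c _ => ?_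
  · refine Finset.mem_filter.2 ⟨Finset.mem_univ _, ?_⟩
    rw [h.mapCrossing_fst, reflectArcs_of_notMem (hout c)]
    exact hout c
  · have h1 := h.mapCrossing_fst (hcross := hcross₀) c
    have h2 := h.mapCrossing_snd (hcross := hcross₀) c
    rw [hcc, h.mapCrossing_fst] at h1
    rw [hcc, h.mapCrossing_snd] at h2
    have hinj := (reflectArcs_involutive h.disjoint).injective
    exact Subtype.ext (Prod.ext (congrArg Prod.snd (hinj h1)).symm
      (congrArg Prod.snd (hinj h2)).symm)
  · have hc0 := (Finset.mem_filter.1 hc).2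
    have hc1 := hself.notMem_of_crossing c hc0
    refine ⟨⟨c.1, ?_⟩, Finset.mem_univ _, Subtype.ext ?_⟩
    · have e0 : L'.curve 0 c.1.1 = L.curve 0 c.1.1 := h.pt_eq _ hc0
      have e1 : L'.curve 1 c.1.2 = L.curve 1 c.1.2 := h.pt_eq _ hc1
      rw [← e0, ← e1]; exact c.2
    · refine Prod.ext ?_ ?_
      · exact (Prod.ext_iff.1 (reflectArcs_of_notMem hc0)).2
      · exact (Prod.ext_iff.1 (reflectArcs_of_notMem hc1)).2
  · rw [OrientedLink.crossingTerm, OrientedLink.crossingTerm,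
      h.ofPath_smoothing_mapCrossing hD hl hr, h.crossingSign_mapCrossing_of_notMem c (hout c)]

end Replaces

/-! ### The supports of the basic moves are simply connected -/

theorem StarConvex.isSimplyConnected {E : Type*} [AddCommGroup E] [Module ℝ E]
    [TopologicalSpace E] [ContinuousAdd E] [ContinuousSMul ℝ E] {s : Set E} {x : E}
    (h : StarConvex ℝ x s) (hne : s.Nonempty) : IsSimplyConnected s :=
  have := h.contractibleSpace hne
  SimplyConnectedSpace.ofContractible s

theorem isSimplyConnected_square : IsSimplyConnected square :=
  (((convex_Icc (-1 : ℝ) 1).prod (convex_Icc (-1 : ℝ) 1)).starConvex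
    (x := ((0 : ℝ), (0 : ℝ))) (by simp)).isSimplyConnected ⟨(0, 0), by simp⟩

/-! ### Star-shaped pieces of books -/

namespace Book

variable {m : ℕ}

/-- The embedding of a book of `m` half-planes into `ℝ^m × ℝ`. -/
def toProd (b : Book m) : (Fin m → ℝ) × ℝ := (b.1.1, b.2)

theorem isEmbedding_toProd : IsEmbedding (toProd (m := m)) :=
  IsEmbedding.subtypeVal.prodMap IsEmbedding.id

theorem toProd_page (i : Fin m) (x h : ℝ) : (page i x h).toProd = (Pi.single i (max h 0), x) :=
  rfl

theorem smul_toProd_page (i : Fin m) (x h : ℝ) {c : ℝ} (hc : 0 ≤ c) :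
    c • (page i x h).toProd = (page i (c * x) (c * h)).toProd := by
  rw [toProd_page, toProd_page, Prod.smul_mk, ← Pi.single_smul, smul_eq_mul, smul_eq_mul,
    mul_max_of_nonneg _ _ hc, mul_zero]

theorem smul_toProd_twoPages (i j : Fin m) (z : ℝ × ℝ) {c : ℝ} (hc : 0 ≤ c) :
    c • (twoPages i j z).toProd = (twoPages i j (c * z.1, c * z.2)).toProd := by
  -- Scaling by `0` may switch the page chosen by `twoPages`, while positive scaling preserves the
  -- sign that selects it.
  rcases eq_or_lt_of_le hc with rfl | hc'
  · ext k <;> simp [twoPages, toProd_page]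
  · unfold twoPages
    have : 0 ≤ c * z.2 ↔ 0 ≤ z.2 := mul_nonneg_iff_of_pos_left hc'
    simp only [this]
    split_ifs
    · exact smul_toProd_page i _ _ hc
    · rw [smul_toProd_page j _ _ hc, mul_neg]

theorem isSimplyConnected_of_starConvex {s : Set (Book m)}
    (h : StarConvex ℝ 0 (toProd '' s)) (hne : s.Nonempty) : IsSimplyConnected s :=
  isEmbedding_toProd.isSimplyConnected_image.1 (h.isSimplyConnected (hne.image _))

theorem isSimplyConnected_twoPages (i j : Fin m) : IsSimplyConnected (twoPages i j '' square) := by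
  refine isSimplyConnected_of_starConvex ?_ ⟨_, (0, 0), by simp [square], rfl⟩
  rintro - ⟨-, ⟨z, hz, rfl⟩, rfl⟩ a b ha hb hab
  refine ⟨_, ⟨(b * z.1, b * z.2), ?_, rfl⟩, ?_⟩
  · obtain ⟨⟨h1, h2⟩, ⟨h3, h4⟩⟩ := hz
    have hb1 : b ≤ 1 := by linarith
    exact ⟨⟨by nlinarith, by nlinarith⟩, ⟨by nlinarith, by nlinarith⟩⟩
  · rw [smul_zero, zero_add, smul_toProd_twoPages _ _ _ hb]

theorem isSimplyConnected_pages (p : Fin m → Prop) (hp : ∃ i, p i) :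
    IsSimplyConnected {b : Book m | ∃ l, p l ∧ ∃ x ∈ Icc (-1 : ℝ) 1, ∃ y ∈ Icc (0 : ℝ) 1,
      b = page l x y} := by
  obtain ⟨i, hi⟩ := hp
  refine isSimplyConnected_of_starConvex ?_
    ⟨page i 0 0, i, hi, 0, by simp, 0, by simp, rfl⟩
  rintro - ⟨-, ⟨l, hl, x, hx, y, hy, rfl⟩, rfl⟩ a b ha hb hab
  have hb1 : b ≤ 1 := by linarith
  refine ⟨_, ⟨l, hl, b * x, ⟨by nlinarith [hx.1, hx.2], by nlinarith [hx.1, hx.2]⟩, b * y,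
    ⟨mul_nonneg hb hy.1, by nlinarith [hy.1, hy.2]⟩, rfl⟩, ?_⟩
  rw [smul_zero, zero_add, smul_toProd_page _ _ _ hb]

theorem twoPages_injective {i j : Fin m} (hij : i ≠ j) :
    Function.Injective (twoPages i j) := by
  -- A left inverse: the coordinate along the ridge, and the difference of the heights in the two
  -- pages.
  have key : ∀ z : ℝ × ℝ,
      ((twoPages i j z).2, (twoPages i j z).1.1 i - (twoPages i j z).1.1 j) = z := by
    rintro ⟨x, y⟩
    unfold twoPages
    split_ifs with h
    · simp only at h
      simp [page, hij.symm, h]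
    · simp only [not_le] at h
      simp [page, hij, h.le]
  intro z w h
  rw [← key z, ← key w, h]

end Book

/-! ### Contraction of cones -/

namespace Cone

section

variable {T : Type}

/-- The contraction of a cone to its apex. -/
def scale (c : unitInterval) : Cone T → Cone T :=
  Quot.lift (Sum.elim (fun _ => Cone.apex T) fun z => Cone.mk z.1 (c * z.2)) (by
    rintro _ _ ⟨t⟩
    simp only [Sum.elim_inr, Sum.elim_inl, mul_zero]
    exact Quot.sound (ConeGlue.base t))

theorem mk_zero (t : T) : Cone.mk t 0 = Cone.apex T := Quot.sound (ConeGlue.base t)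

end

variable {T : Type} [TopologicalSpace T]

theorem continuous_mk : Continuous fun z : T × unitInterval => Cone.mk z.1 z.2 :=
  continuous_quot_mk.comp continuous_inr

/-- The quotient map onto the cone stays a quotient map after multiplication by the locally compact
interval, so joint continuity can be checked on the cylinder. -/
theorem continuous_scale : Continuous fun z : unitInterval × Cone T => scale z.1 z.2 := by
  refine (isQuotientMap_quot_mk (r := ConeGlue T)).continuous_lift_prod_right
    (g := fun z : unitInterval × Cone T => scale z.1 z.2) ?_
  rw [← (Homeomorph.prodSumDistrib (X := unitInterval) (Y := Unit)
    (Z := T × unitInterval)).symm.comp_continuous_iff', continuous_sum_dom]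
  constructor
  · exact continuous_const
  · exact continuous_mk.comp (f := fun z : unitInterval × (T × unitInterval) =>
      (z.2.1, z.1 * z.2.2)) (by fun_prop)

/-- The cone over a nonempty subset of the base is simply connected. -/
theorem isSimplyConnected_subcone {S : Set T} (hS : S.Nonempty) :
    IsSimplyConnected {y : Cone T | ∃ t ∈ S, ∃ r, y = Cone.mk t r} := by
  obtain ⟨t₀, ht₀⟩ := hS
  set K := {y : Cone T | ∃ t ∈ S, ∃ r, y = Cone.mk t r}
  have hscale : ∀ c : unitInterval, ∀ y ∈ K, scale c y ∈ K := by
    rintro c _ ⟨t, ht, r, rfl⟩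
    exact ⟨t, ht, c * r, rfl⟩
  have hapex : Cone.apex T ∈ K := ⟨t₀, ht₀, 0, (mk_zero t₀).symm⟩
  have : ContractibleSpace K := by
    refine contractible_iff_id_nullhomotopic K |>.2 ⟨⟨_, hapex⟩, ⟨ContinuousMap.Homotopy.symm ?_⟩⟩
    refine ⟨⟨fun z => ⟨scale z.1 z.2, hscale _ _ z.2.2⟩, ?_⟩, ?_, ?_⟩
    · exact (continuous_scale.comp (f := fun z : unitInterval × K => (z.1, (z.2 : Cone T)))
        (by fun_prop)).subtype_mk _
    · rintro ⟨_, t, ht, r, rfl⟩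
      refine Subtype.ext ?_
      change Cone.mk t (0 * r) = _
      rw [zero_mul]; exact mk_zero t
    · rintro ⟨_, t, ht, r, rfl⟩
      refine Subtype.ext ?_
      change Cone.mk t (1 * r) = _
      rw [one_mul]; rfl
  exact SimplyConnectedSpace.ofContractible K

end Cone

/-! ### Invariance of the linking class under the basic moves -/

/-- Translates directions of the arc coordinate into the orientation of the curve, with the same `a`
at all points, so that moves need no case distinction on orientations. -/
theorem Arc.exists_side_eq {n : ℕ} (e : Arc n) : ∃ a, ∀ s, e.side s a = (e.pt s, true) := by
  by_cases h : 0 < e.half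
  · exact ⟨true, fun s => by simp [Arc.side, h]⟩
  · exact ⟨false, fun s => by simp [Arc.side, h]⟩

namespace OrientedLink

variable {X : Type*} [TopologicalSpace X] {n : ℕ}

theorem sign_eq_of_side {L L' : OrientedLink X n} {e f : Arc n} {s t s' t' : ℝ}
    (h : ∀ a b, L'.dots (e.side s' a) (f.side t' b) ↔ L.dots (e.side s a) (f.side t b)) :
    L'.sign (e.pt s') (f.pt t') = L.sign (e.pt s) (f.pt t) := by
  obtain ⟨a, ha⟩ := e.exists_side_eq
  obtain ⟨b, hb⟩ := f.exists_side_eq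
  have h1 := h a b
  simp only [ha, hb] at h1
  exact sign_congr h1

/-- Whether the two arc coordinates agree with the orientations in the same way is one condition for
both corners, so exactly one dotted corner means opposite signs. -/
theorem sign_eq_neg_of_side {L : OrientedLink X n} {e f : Arc n} {s t s' t' : ℝ}
    (hne : e.pt s ≠ f.pt t) (hne' : e.pt s' ≠ f.pt t')
    (hst : L.pt (e.pt s) = L.pt (f.pt t)) (hst' : L.pt (e.pt s') = L.pt (f.pt t'))
    (h : L.dots (e.side s true) (f.side t true) ↔
      ¬ L.dots (e.side s' false) (f.side t' false)) :
    L.sign (e.pt s') (f.pt t') = -L.sign (e.pt s) (f.pt t) := by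
  simp only [Arc.side] at h
  rw [L.dots_iff hne hst, L.dots_iff hne' hst'] at h
  have h1 : L.dots (e.pt s, true) (f.pt t, true) ↔ ¬ L.dots (e.pt s', true) (f.pt t', true) := by
    by_cases he : 0 < e.half <;> by_cases hf : 0 < f.half <;> simp [he, hf] at h <;> tauto
  unfold sign
  split_ifs <;> simp_all

end OrientedLink

section Moves

variable {X : Type*} [TopologicalSpace X]

theorem Replaces.LK_eq_of_single {L L' : OrientedLink X 2} {D : Set X} {e : Fin 1 → Arc 2}
    {u u' : ℝ → X} (h : Replaces L L' D e ![u] ![u']) (hD : IsSimplyConnected D)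
    (hl : u' (-1) = u (-1)) (hr : u' 1 = u 1) : L.LK = L'.LK :=
  h.LK_eq hD (fun i => by fin_cases i; exact hl) (fun i => by fin_cases i; exact hr)
    (fun i j hij => absurd (Subsingleton.elim i j) hij)
    (fun i j hij => absurd (Subsingleton.elim i j) hij)
    (fun i j hij => absurd (Subsingleton.elim i j) hij)

theorem Fin.forall_ne_of_forall_lt {k : ℕ} {P : Fin k → Fin k → Prop}
    (hsymm : ∀ i j, P i j → P j i) (h : ∀ i j, i < j → P i j) (i j : Fin k) (hij : i ≠ j) :
    P i j :=
  hij.lt_or_gt.elim (h i j) fun hji => hsymm j i (h j i hji)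

theorem IsSimplyConnected.image_twoPages {m : ℕ} {ψ : Book m → X} (hψ : IsOpenEmbedding ψ)
    (i j : Fin m) : IsSimplyConnected ((fun z => ψ (Book.twoPages i j z)) '' square) := by
  have := hψ.isEmbedding.isSimplyConnected_image.2 (Book.isSimplyConnected_twoPages i j)
  rwa [image_image] at this

namespace Replaces

variable {k : ℕ} {L L' : OrientedLink X 2} {D : Set X} {e : Fin k → Arc 2} {u u' : Fin k → ℝ → X}

/-- A variant of `Replaces.LK_eq` with each pair of arcs considered only once. -/
theorem LK_eq_of_lt (h : Replaces L L' D e u u') (hD : IsSimplyConnected D)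
    (hl : ∀ i, u' i (-1) = u i (-1)) (hr : ∀ i, u' i 1 = u i 1)
    (hcross : ∀ i j, i < j → ∀ s t, u i s = u j t ∧ s ∈ Icc (-1 : ℝ) 1 → u' i (-s) = u' j (-t) ∧
      ∀ a b, L'.dots ((e i).side (-s) a) ((e j).side (-t) b) ↔
        L.dots ((e i).side s a) ((e j).side t b))
    (hcross' : ∀ i j, i < j → ∀ s t, u' i s = u' j t ∧ s ∈ Icc (-1 : ℝ) 1 →
      u i (-s) = u j (-t)) : L.LK = L'.LK := by
  have h1 := Fin.forall_ne_of_forall_lt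
    (P := fun i j => ∀ s ∈ Icc (-1 : ℝ) 1, ∀ t ∈ Icc (-1 : ℝ) 1, u i s = u j t →
      u' i (-s) = u' j (-t) ∧
      L'.sign ((e i).pt (-s)) ((e j).pt (-t)) = L.sign ((e i).pt s) ((e j).pt t))
    (fun i j H s hs t ht hst => by
      have := H t ht s hs hst.symm
      rw [L.sign_comm, L'.sign_comm]
      exact ⟨this.1.symm, this.2⟩)
    (fun i j hij s hs t _ hst => ⟨(hcross i j hij s t ⟨hst, hs⟩).1,
      OrientedLink.sign_eq_of_side (hcross i j hij s t ⟨hst, hs⟩).2⟩)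
  have h2 := Fin.forall_ne_of_forall_lt
    (P := fun i j => ∀ s ∈ Icc (-1 : ℝ) 1, ∀ t ∈ Icc (-1 : ℝ) 1, u' i s = u' j t →
      u i (-s) = u j (-t))
    (fun i j H s hs t ht hst => (H t ht s hs hst.symm).symm)
    (fun i j hij s hs t _ hst => hcross' i j hij s t ⟨hst, hs⟩)
  exact h.LK_eq hD hl hr (fun i j hij s hs t ht hst => (h1 i j hij s hs t ht hst).1) h2
    (fun i j hij s hs t ht hst => (h1 i j hij s hs t ht hst).2)

/-- The two parabolas meet at equal coordinates `s = t` with `4 * s ^ 2 = 1`. Reflection exchanges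
these corners, and the bigon being dotted at just one of them makes their signs opposite. -/
theorem LK_eq_of_bigon {φ : ℝ × ℝ → X} (hφ : IsOpenEmbedding φ) {e : Fin 2 → Arc 2}
    (h : Replaces L L' (φ '' square) e
      ![fun s => φ (s, 1 / 2), fun s => φ (s, -1 / 2)]
      ![fun s => φ (s, (4 * s ^ 2 - 1) / 6), fun s => φ (s, -(4 * s ^ 2 - 1) / 6)])
    (hdots : L'.dots ((e 0).side (-1 / 2) true) ((e 1).side (-1 / 2) true) ↔
      ¬ L'.dots ((e 0).side (1 / 2) false) ((e 1).side (1 / 2) false)) : L.LK = L'.LK := by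
  have hinj := hφ.injective
  have hlt : ∀ i j : Fin 2, i < j → i = 0 ∧ j = 1 := by decide
  have hhalf : ∀ s t : ℝ, ((s, (4 * s ^ 2 - 1) / 6) : ℝ × ℝ) = (t, -(4 * t ^ 2 - 1) / 6) →
      t = s ∧ (s = -1 / 2 ∨ s = 1 / 2) := by
    intro s t hst
    obtain ⟨rfl, h2⟩ := Prod.ext_iff.1 hst
    simp only at h2
    refine ⟨rfl, ?_⟩
    have h3 : (s + 1 / 2) * (s - 1 / 2) = 0 := by linarith
    rcases mul_eq_zero.1 h3 with h4 | h4
    · left; linarith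
    · right; linarith
  have hends : (-1 / 2 : ℝ) ∈ Icc (-1 : ℝ) 1 ∧ (1 / 2 : ℝ) ∈ Icc (-1 : ℝ) 1 := by
    constructor <;> constructor <;> norm_num
  have hpt : ∀ s ∈ Icc (-1 : ℝ) 1, (4 * s ^ 2 - 1 = 0) →
      L'.pt ((e 0).pt s) = L'.pt ((e 1).pt s) := fun s hs h0 => by
    rw [h.after 0 s hs, h.after 1 s hs]
    change φ (_, _) = φ (_, _)
    rw [h0, neg_zero]
  have hne : ∀ s ∈ Icc (-1 : ℝ) 1, (e 0).pt s ≠ (e 1).pt s := fun s hs h0 =>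
    absurd (h.disjoint 0 1 s hs s hs h0).1 (by decide)
  have hsign : L'.sign ((e 0).pt (1 / 2)) ((e 1).pt (1 / 2)) =
      -L'.sign ((e 0).pt (-1 / 2)) ((e 1).pt (-1 / 2)) :=
    OrientedLink.sign_eq_neg_of_side (hne _ hends.1) (hne _ hends.2)
      (hpt _ hends.1 (by norm_num)) (hpt _ hends.2 (by norm_num)) hdots
  have h1 := Fin.forall_ne_of_forall_lt (k := 2)
    (P := fun i j => ∀ s t : ℝ,
      (![fun s => φ (s, (4 * s ^ 2 - 1) / 6), fun s => φ (s, -(4 * s ^ 2 - 1) / 6)] :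
        Fin 2 → ℝ → X) i s =
      (![fun s => φ (s, (4 * s ^ 2 - 1) / 6), fun s => φ (s, -(4 * s ^ 2 - 1) / 6)] :
        Fin 2 → ℝ → X) j t →
      s = t ∧ (s = -1 / 2 ∨ s = 1 / 2) ∧
      L'.sign ((e i).pt (-s)) ((e j).pt (-t)) = -1 * L'.sign ((e i).pt s) ((e j).pt t))
    (fun i j H s t hst => by
      obtain ⟨rfl, H1, H2⟩ := H t s hst.symm
      rw [L'.sign_comm, L'.sign_comm ((e j).pt t)]
      exact ⟨rfl, H1, H2⟩)
    (fun i j hij s t hst => by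
      obtain ⟨rfl, rfl⟩ := hlt i j hij
      obtain ⟨rfl, h2⟩ := hhalf s t (hinj hst)
      refine ⟨rfl, h2, ?_⟩
      rcases h2 with rfl | rfl
      · rw [show -(-1 / 2 : ℝ) = 1 / 2 by norm_num, hsign, neg_one_mul]
      · rw [show -(1 / 2 : ℝ) = -1 / 2 by norm_num, hsign, neg_one_mul, neg_neg])
  refine h.LK_eq_of_cancel (hφ.isEmbedding.isSimplyConnected_image.2 isSimplyConnected_square)
    (fun i => ?_) (fun i => ?_) ?_ (fun i j hij s _ t _ hst => ?_)
    (fun i j hij s _ t _ hst => (h1 i j hij s t hst).2.2)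
  · fin_cases i <;> norm_num
  · fin_cases i <;> norm_num
  · refine Fin.forall_ne_of_forall_lt (fun i j H s hs t ht hst => H t ht s hs hst.symm)
      fun i j hij s hs t ht hst => ?_
    obtain ⟨rfl, rfl⟩ := hlt i j hij
    have := (Prod.ext_iff.1 (hinj hst)).2
    norm_num at this
  · obtain ⟨rfl, h2, -⟩ := h1 i j hij s t hst
    have h0 : 4 * s ^ 2 - 1 = 0 := by rcases h2 with rfl | rfl <;> norm_num
    have : ∀ l : Fin 2, (![fun s => φ (s, (4 * s ^ 2 - 1) / 6),
        fun s => φ (s, -(4 * s ^ 2 - 1) / 6)] : Fin 2 → ℝ → X) l (-s) = φ (-s, 0) := by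
      intro l
      fin_cases l <;> change φ (_, _) = φ (_, _) <;> rw [neg_sq, h0] <;> norm_num
    rw [this, this]

/-- The crossings of strand `0` with strands `1` and `2` move from the coordinates `-1/2`, `1/2` to
`1/2`, `-1/2`, and that of strands `1` and `2` stays at `0`: this is the reflection of all arcs. -/
theorem LK_eq_of_triangle {φ : ℝ × ℝ → X} (hφ : IsOpenEmbedding φ) {e : Fin 3 → Arc 2}
    (h : Replaces L L' (φ '' square) e
      ![fun s => φ (s, -(2 * (1 - s ^ 2)) / 3), fun s => φ (s, s), fun s => φ (s, -s)]
      ![fun s => φ (s, 2 * (1 - s ^ 2) / 3), fun s => φ (s, s), fun s => φ (s, -s)])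
    (h01 : ∀ a b, L'.dots ((e 0).side (1 / 2) a) ((e 1).side (1 / 2) b) ↔
      L.dots ((e 0).side (-1 / 2) a) ((e 1).side (-1 / 2) b))
    (h02 : ∀ a b, L'.dots ((e 0).side (-1 / 2) a) ((e 2).side (-1 / 2) b) ↔
      L.dots ((e 0).side (1 / 2) a) ((e 2).side (1 / 2) b))
    (h12 : ∀ a b, L'.dots ((e 1).side 0 a) ((e 2).side 0 b) ↔
      L.dots ((e 1).side 0 a) ((e 2).side 0 b)) : L.LK = L'.LK := by
  have hinj := hφ.injective
  have hlt : ∀ i j : Fin 3, i < j → (i = 0 ∧ j = 1) ∨ (i = 0 ∧ j = 2) ∨ (i = 1 ∧ j = 2) := by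
    decide
  -- Up to the sign of `s`, the parabola meets a diagonal where `2 * s ^ 2 - 3 * s - 2 = 0`; the
  -- second root `2` lies off the arc.
  have hroot : ∀ s : ℝ, s ∈ Icc (-1 : ℝ) 1 → (s + 1 / 2) * (s - 2) = 0 → s = -1 / 2 := by
    intro s hs h0
    rcases mul_eq_zero.1 h0 with h1 | h1 <;> linarith [hs.2]
  refine h.LK_eq_of_lt (hφ.isEmbedding.isSimplyConnected_image.2 isSimplyConnected_square)
    (fun i => ?_) (fun i => ?_) (fun i j hij s t hst => ?_) (fun i j hij s t hst => ?_)
  · fin_cases i <;> norm_num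
  · fin_cases i <;> norm_num
  · obtain ⟨hst, hs⟩ := hst
    rcases hlt i j hij with ⟨rfl, rfl⟩ | ⟨rfl, rfl⟩ | ⟨rfl, rfl⟩
    · obtain ⟨h1, h2⟩ := Prod.ext_iff.1 (hinj hst)
      simp only at h1 h2
      subst h1
      obtain rfl := hroot s hs (by linarith)
      rw [show -(-1 / 2 : ℝ) = 1 / 2 by norm_num]
      exact ⟨by change φ (_, _) = φ (_, _); norm_num, h01⟩
    · obtain ⟨h1, h2⟩ := Prod.ext_iff.1 (hinj hst)
      simp only at h1 h2
      subst h1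
      have := hroot (-s) (neg_mem_Icc_neg_one_one hs) (by linarith)
      obtain rfl : s = 1 / 2 := by linarith
      rw [show -(1 / 2 : ℝ) = -1 / 2 by norm_num]
      exact ⟨by change φ (_, _) = φ (_, _); norm_num, h02⟩
    · obtain ⟨h1, h2⟩ := Prod.ext_iff.1 (hinj hst)
      simp only at h1 h2
      subst h1
      obtain rfl : s = 0 := by linarith
      rw [neg_zero]
      exact ⟨by change φ (_, _) = φ (_, _); norm_num, h12⟩
  · obtain ⟨hst, hs⟩ := hst
    rcases hlt i j hij with ⟨rfl, rfl⟩ | ⟨rfl, rfl⟩ | ⟨rfl, rfl⟩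
    · obtain ⟨h1, h2⟩ := Prod.ext_iff.1 (hinj hst)
      simp only at h1 h2
      subst h1
      have := hroot (-s) (neg_mem_Icc_neg_one_one hs) (by linarith)
      obtain rfl : s = 1 / 2 := by linarith
      change φ (_, _) = φ (_, _)
      norm_num
    · obtain ⟨h1, h2⟩ := Prod.ext_iff.1 (hinj hst)
      simp only at h1 h2
      subst h1
      obtain rfl := hroot s hs (by linarith)
      change φ (_, _) = φ (_, _)
      norm_num
    · obtain ⟨h1, h2⟩ := Prod.ext_iff.1 (hinj hst)
      simp only at h1 h2
      subst h1
      obtain rfl : s = 0 := by linarith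
      change φ (_, _) = φ (_, _)
      norm_num

/-- Two pages unroll injectively to a plane, so crossings are computed there. The single crossing
passes from coordinate `-1/2` to `1/2` on both arcs. -/
theorem LK_eq_of_crossing_ridge {m : ℕ} {ψ : Book m → X} (hψ : IsOpenEmbedding ψ) {i j : Fin m}
    (hij : i ≠ j) {e : Fin 2 → Arc 2}
    (h : Replaces L L' ((fun z => ψ (Book.twoPages i j z)) '' square) e
      ![fun s => ψ (Book.twoPages i j ((3 * s + 2 * (1 - s ^ 2)) / 6, s)),
        fun s => ψ (Book.twoPages i j (-(3 * s + 2 * (1 - s ^ 2)) / 6, s))]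
      ![fun s => ψ (Book.twoPages i j ((3 * s - 2 * (1 - s ^ 2)) / 6, s)),
        fun s => ψ (Book.twoPages i j (-(3 * s - 2 * (1 - s ^ 2)) / 6, s))])
    (hdots : ∀ a b, L'.dots ((e 0).side (1 / 2) a) ((e 1).side (1 / 2) b) ↔
      L.dots ((e 0).side (-1 / 2) a) ((e 1).side (-1 / 2) b)) : L.LK = L'.LK := by
  have hinj := hψ.injective.comp (Book.twoPages_injective hij)
  have hlt : ∀ i j : Fin 2, i < j → i = 0 ∧ j = 1 := by decide
  have hroot : ∀ s : ℝ, s ∈ Icc (-1 : ℝ) 1 → (s + 1 / 2) * (s - 2) = 0 → s = -1 / 2 := by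
    intro s hs h0
    rcases mul_eq_zero.1 h0 with h1 | h1 <;> linarith [hs.2]
  refine h.LK_eq_of_lt (IsSimplyConnected.image_twoPages hψ i j)
    (fun l => ?_) (fun l => ?_) (fun l l' hl s t hst => ?_) (fun l l' hl s t hst => ?_)
  · fin_cases l <;> norm_num
  · fin_cases l <;> norm_num
  · obtain ⟨hst, hs⟩ := hst
    obtain ⟨rfl, rfl⟩ := hlt l l' hl
    obtain ⟨h1, h2⟩ := Prod.ext_iff.1 (hinj hst)
    simp only at h1 h2
    subst h2
    obtain rfl := hroot s hs (by linarith)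
    rw [show -(-1 / 2 : ℝ) = 1 / 2 by norm_num]
    exact ⟨by norm_num, hdots⟩
  · obtain ⟨hst, hs⟩ := hst
    obtain ⟨rfl, rfl⟩ := hlt l l' hl
    obtain ⟨h1, h2⟩ := Prod.ext_iff.1 (hinj hst)
    simp only at h1 h2
    subst h2
    have := hroot (-s) (neg_mem_Icc_neg_one_one hs) (by linarith)
    obtain rfl : s = 1 / 2 := by linarith
    norm_num

end Replaces

theorem BasicMove.LK_eq {L L' : OrientedLink X 2} (h : BasicMove L L') : L.LK = L'.LK := by
  induction h with
  | M1 φ hφ e h =>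
    exact h.LK_eq_of_single (hφ.isEmbedding.isSimplyConnected_image.2 isSimplyConnected_square)
      (by norm_num) (by norm_num)
  | M2 φ hφ e h hdots => exact Replaces.LK_eq_of_bigon hφ h hdots
  | M3 φ hφ e h h01 h02 h12 _ => exact Replaces.LK_eq_of_triangle hφ h h01 h02 h12
  | M4 m hm ψ hψ i j hij e h =>
    exact h.LK_eq_of_single (IsSimplyConnected.image_twoPages hψ i j) (by norm_num) (by norm_num)
  | M5 m hm ψ hψ i j hij e h hdots => exact Replaces.LK_eq_of_crossing_ridge hψ hij h hdots
  | M6 m ψ hψ i j k hij hik hjk e h =>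
    exact h.LK_eq_of_single (hψ.isEmbedding.isSimplyConnected_image.2
      (Book.isSimplyConnected_pages _ ⟨i, Or.inl rfl⟩)) (by norm_num) (by norm_num)
  | M7 x hx Γ f hf S hS e u u' hu hu' hl hr hl_mem hr_mem h =>
    refine h.LK_eq_of_single ?_ hl hr
    -- The endpoint of the arc shows that `S` is nonempty, so the disc contains the apex and
    -- contracts to it.
    obtain ⟨t, ht, -⟩ := hl_mem
    have h1 := hf.isClosedEmbedding.isEmbedding.isSimplyConnected_image.2
      (Cone.isSimplyConnected_subcone ⟨t, ht⟩)
    convert h1 using 1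
    ext y
    constructor
    · rintro ⟨t, ht, r, rfl⟩
      exact ⟨_, ⟨t, ht, r, rfl⟩, rfl⟩
    · rintro ⟨_, ⟨t, ht, r, rfl⟩, rfl⟩
      exact ⟨t, ht, r, rfl⟩

end Moves

/-! ### Reparametrizations, ambient isotopies, mirror images and reversals -/

section

variable {X : Type*} [TopologicalSpace X]

theorem FreeLoopClass.ofPath_congr {x y : X} {p : Path x x} {q : Path y y}
    (h : ∀ t, p t = q t) : ofPath p = ofPath q := by
  obtain rfl : x = y := by simpa using h 0
  exact congrArg ofPath (Path.ext (funext h))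

theorem FreeLoopClass.ofPath_trans_cast_comm {x y : X} (p : Path x x) (q : Path y y)
    (h : x = y) :
    ofPath (p.trans (q.cast h h)) = ofPath (q.trans (p.cast h.symm h.symm)) := by
  subst h
  exact ofPath_trans_comm p q

theorem Path.trans_homotopic_trans_of_const {x y : X} {a : Path x x} {b : Path y y} (h : x = y)
    (hab : a.Homotopic (b.cast h h)) {δ : Path x y} (hδ : ∀ t, δ t = x) :
    (a.trans δ).Homotopic (δ.trans b) := by
  subst h
  obtain rfl : δ = Path.refl x := Path.ext (funext hδ)
  exact ((Path.Homotopic.trans_refl a).trans hab).trans (Path.Homotopic.refl_trans b).symm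

/-- A loop does not change its homotopy class under an orientation preserving change of the
parameter. -/
theorem loopFrom_homotopic_of_reparam {γ γ' : C(UnitAddCircle, X)} (f : ℝ ≃o ℝ)
    (hf : ∀ x, f (x + 1) = f x + 1)
    (h : ∀ x : ℝ, γ' (x : UnitAddCircle) = γ (f x : UnitAddCircle)) (x : ℝ) :
    (loopFrom γ' (x : UnitAddCircle)).Homotopic
      ((loopFrom γ (f x : UnitAddCircle)).cast (h x) (h x)) := by
  -- Both loops run along `γ`, with parameters `f (x + t)` and `f x + t`, which agree at both ends
  -- by periodicity of the lift.
  refine homotopic_of_lift_real (fun r : ℝ => γ r)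
    (γ.continuous.comp (AddCircle.continuous_mk' 1)) _ _ (fun t => f (x + t * (x + 1 - x)))
    (fun t => f x + t * (f x + 1 - f x)) (f.continuous.comp (by fun_prop)) (by fun_prop)
    (by simp) (by simp [hf]) (fun t => ?_) (fun t => isSegment_loopFrom γ (f x) t)
  exact (isSegment_loopFrom γ' x t).trans (h _)

/-- The homeomorphism of the circle with a given lift, as a bijection. -/
noncomputable def circleEquivOfLift (f : ℝ ≃o ℝ) (hf : ∀ x, f (x + 1) = f x + 1) :
    UnitAddCircle ≃ UnitAddCircle where
  toFun := Function.Periodic.lift (f := fun x : ℝ => (f x : UnitAddCircle)) (c := 1) fun x => by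
    simp only [hf, AddCircle.coe_add, AddCircle.coe_period, add_zero]
  invFun := Function.Periodic.lift (f := fun x : ℝ => (f.symm x : UnitAddCircle)) (c := 1)
    fun x => by
      have : f.symm (x + 1) = f.symm x + 1 := by
        rw [OrderIso.symm_apply_eq, hf, OrderIso.apply_symm_apply]
      simp only [this, AddCircle.coe_add, AddCircle.coe_period, add_zero]
  left_inv s := by
    obtain ⟨x, rfl⟩ := UnitAddCircle.exists_coe_unitInterval s
    change ((f.symm (f x) : ℝ) : UnitAddCircle) = _
    rw [OrderIso.symm_apply_apply]
  right_inv s := by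
    obtain ⟨x, rfl⟩ := UnitAddCircle.exists_coe_unitInterval s
    change ((f (f.symm x) : ℝ) : UnitAddCircle) = _
    rw [OrderIso.apply_symm_apply]

namespace OrientedLink

theorem SameLink.LK_eq {L L' : OrientedLink X 2} (h : SameLink L L') : L.LK = L'.LK := by
  obtain ⟨σ, f, hf, hcurve, hdots⟩ := h
  let F : Fin 2 → UnitAddCircle ≃ UnitAddCircle := fun i => circleEquivOfLift (f i) (hf i)
  have hF : ∀ i s, L'.curve i s = L.curve (σ i) (F i s) := fun i s => by
    obtain ⟨x, rfl⟩ := UnitAddCircle.exists_coe_unitInterval s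
    exact hcurve i x
  have hsign : ∀ i s j t, L.sign (σ i, F i s) (σ j, F j t) = L'.sign (i, s) (j, t) := by
    intro i s j t
    obtain ⟨x, rfl⟩ := UnitAddCircle.exists_coe_unitInterval s
    obtain ⟨y, rfl⟩ := UnitAddCircle.exists_coe_unitInterval t
    exact sign_congr (hdots i x true j y true).symm
  -- Separate indices `i'`, `j'` allow substitution of `σ i`, `σ j` and serve both permutations.
  have hclass : ∀ i i' j j', σ i = i' → σ j = j' → ∀ s t
      (h : L.curve i' (F i s) = L.curve j' (F j t)) (h' : L'.curve i s = L'.curve j t),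
      FreeLoopClass.ofPath ((loopFrom (L.curve i') (F i s)).trans
        ((loopFrom (L.curve j') (F j t)).cast h h)) =
      FreeLoopClass.ofPath ((loopFrom (L'.curve i) s).trans
        ((loopFrom (L'.curve j) t).cast h' h')) := by
    rintro i _ j _ rfl rfl s t h h'
    obtain ⟨x, rfl⟩ := UnitAddCircle.exists_coe_unitInterval s
    obtain ⟨y, rfl⟩ := UnitAddCircle.exists_coe_unitInterval t
    let δ : Path (L'.curve i ((x : ℝ) : UnitAddCircle)) (L.curve (σ i) (F i (x : ℝ))) :=
      (Path.refl _).cast rfl (hF i _).symm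
    exact (FreeLoopClass.ofPath_trans_cast_eq _ _ h' _ _ h δ (δ.cast h'.symm h.symm)
      (fun _ => rfl)
      (Path.trans_homotopic_trans_of_const (hF i _)
        (loopFrom_homotopic_of_reparam (f i) (hf i) (hcurve i) x) fun _ => rfl)
      (Path.trans_homotopic_trans_of_const (hF j _)
        (loopFrom_homotopic_of_reparam (f j) (hf j) (hcurve j) y) fun _ => h')).symm
  rw [L.LK_eq_sum, L'.LK_eq_sum]
  symm
  have hσ : (σ 0 = 0 ∧ σ 1 = 1) ∨ (σ 0 = 1 ∧ σ 1 = 0) := by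
    have h01 : σ 0 ≠ σ 1 := fun h => absurd (σ.injective h) (by decide)
    omega
  rcases hσ with ⟨h0, h1⟩ | ⟨h0, h1⟩
  · have hmap : ∀ s t, L'.curve 0 s = L'.curve 1 t ↔ L.curve 0 (F 0 s) = L.curve 1 (F 1 t) := by
      intro s t; rw [hF, hF, h0, h1]
    refine Finset.sum_bij' (fun c _ => ⟨(F 0 c.1.1, F 1 c.1.2), (hmap _ _).1 c.2⟩)
      (fun c _ => ⟨((F 0).symm c.1.1, (F 1).symm c.1.2), (hmap _ _).2 (by simpa using c.2)⟩)
      (fun _ _ => Finset.mem_univ _) (fun _ _ => Finset.mem_univ _)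
      (fun c _ => Subtype.ext (by simp)) (fun c _ => Subtype.ext (by simp)) ?_
    rintro ⟨⟨s, t⟩, hc⟩ -
    have hs := hsign 0 s 1 t
    have hcl := hclass 0 0 1 1 h0 h1 s t ((hmap _ _).1 hc) hc
    rw [h0, h1] at hs
    exact congrArg₂ Finsupp.single hcl.symm hs.symm
  -- When the components are exchanged, the smoothing runs through them in the other order, which is
  -- a cyclic rotation of the loop, and the sign is symmetric.
  · have hmap : ∀ s t, L'.curve 0 s = L'.curve 1 t ↔ L.curve 0 (F 1 t) = L.curve 1 (F 0 s) := by
      intro s t; rw [hF, hF, h0, h1, eq_comm]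
    refine Finset.sum_bij' (fun c _ => ⟨(F 1 c.1.2, F 0 c.1.1), (hmap _ _).1 c.2⟩)
      (fun c _ => ⟨((F 0).symm c.1.2, (F 1).symm c.1.1), (hmap _ _).2 (by simpa using c.2)⟩)
      (fun _ _ => Finset.mem_univ _) (fun _ _ => Finset.mem_univ _)
      (fun c _ => Subtype.ext (by simp)) (fun c _ => Subtype.ext (by simp)) ?_
    rintro ⟨⟨s, t⟩, hc⟩ -
    have hs := (hsign 1 t 0 s).trans (L'.sign_comm _ _)
    have hcl := (hclass 1 0 0 1 h1 h0 t s ((hmap _ _).1 hc) hc.symm).trans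
      (FreeLoopClass.ofPath_trans_cast_comm _ _ hc).symm
    rw [h0, h1] at hs
    exact congrArg₂ Finsupp.single hcl.symm hs.symm

/-- Injectivity of the end map preserves the crossing parameters, and the isotopy applied to a
smoothed loop is a free homotopy to the new one. -/
theorem AmbientIsotopic.LK_eq {L L' : OrientedLink X 2} (h : AmbientIsotopic L L') :
    L.LK = L'.LK := by
  obtain ⟨H, h0, hH, hpt, hdots⟩ := h
  have hcurve : ∀ i s, L'.curve i s = H (1, L.curve i s) := fun i s => hpt (i, s)
  have hmap : ∀ s t, L.curve 0 s = L.curve 1 t ↔ L'.curve 0 s = L'.curve 1 t := fun s t => by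
    rw [hcurve, hcurve, (hH 1).injective.eq_iff]
  rw [L.LK_eq_sum, L'.LK_eq_sum]
  refine Finset.sum_bij' (fun c _ => ⟨c.1, (hmap _ _).1 c.2⟩) (fun c _ => ⟨c.1, (hmap _ _).2 c.2⟩)
    (fun _ _ => Finset.mem_univ _) (fun _ _ => Finset.mem_univ _) (fun _ _ => rfl)
    (fun _ _ => rfl) ?_
  rintro ⟨⟨s, t⟩, hc⟩ -
  refine congrArg₂ Finsupp.single ?_ (sign_congr (hdots _ _).symm)
  refine FreeLoopClass.ofPath_eq_of_family _ _
    ⟨fun z => H (z.1, L.smoothing ⟨(s, t), hc⟩ z.2), by fun_prop⟩ (fun r => h0 _) (fun r => ?_)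
    (fun τ => ?_)
  · simp only [smoothing, ContinuousMap.coe_mk, Path.trans_apply]
    split_ifs
    · exact (hcurve 0 _).symm
    · exact (hcurve 1 _).symm
  · simp

theorem LK_eq_of_isotopic {L L' : OrientedLink X 2} (h : L.Isotopic L') : L.LK = L'.LK := by
  induction h with
  | rel L L' h =>
    rcases h with h | h | h
    · exact h.LK_eq
    · exact h.LK_eq
    · exact h.LK_eq
  | refl L => rfl
  | symm L L' _ ih => exact ih.symm
  | trans L L' L'' _ _ ih ih' => exact ih.trans ih'

/-! ### Augmentation, mirror image and reversal -/

theorem augmentation_LK (L : OrientedLink X 2) : augmentation X L.LK = L.lk := by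
  rw [LK, lk, map_sum]
  exact Finset.sum_congr rfl fun c _ => by simp [augmentation]

theorem LK_mirror (L : OrientedLink X 2) : L.mirror.LK = -L.LK := by
  rw [LK_eq_sum, LK_eq_sum, ← Finset.sum_neg_distrib]
  refine Finset.sum_bij' (fun c _ => ⟨c.1, c.2⟩) (fun c _ => ⟨c.1, c.2⟩)
    (fun _ _ => Finset.mem_univ _) (fun _ _ => Finset.mem_univ _) (fun _ _ => rfl)
    (fun _ _ => rfl) ?_
  rintro ⟨⟨s, t⟩, hc⟩ -
  have hc' : L.curve 0 s = L.curve 1 t := hc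
  have hdots : L.mirror.dots ((0, s), true) ((1, t), true) ↔
      ¬ L.dots ((0, s), true) ((1, t), true) :=
    ⟨fun h => h.2, fun h => ⟨⟨fun h' =>
      absurd (congrArg Prod.fst h') (show (0 : Fin 2) ≠ 1 by decide), hc'⟩, h⟩⟩
  have hsign : L.mirror.sign (0, s) (1, t) = -L.sign (0, s) (1, t) := by
    unfold sign
    split_ifs <;> simp_all
  have hterm : L.mirror.crossingTerm ⟨(s, t), hc⟩ =
      Finsupp.single (FreeLoopClass.ofPath (L.smoothing ⟨(s, t), hc'⟩))
        (-L.crossingSign ⟨(s, t), hc'⟩) := congrArg₂ Finsupp.single rfl hsign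
  rw [hterm, Finsupp.single_neg]
  rfl

theorem loopFrom_comp_circleNeg (γ : C(UnitAddCircle, X)) (s : UnitAddCircle)
    (t : unitInterval) :
    loopFrom (γ.comp circleNeg) s t = loopFrom γ (-s) (unitInterval.symm t) := by
  change γ (-(s + ((t : ℝ) : UnitAddCircle))) =
    γ (-s + ((1 - (t : ℝ) : ℝ) : UnitAddCircle))
  rw [AddCircle.coe_sub, AddCircle.coe_period]
  congr 1; abel

/-- Reversal exchanges the outgoing and the incoming area, which are opposite and dotted together,
so signs persist. The smoothing `αβ` becomes `α⁻¹β⁻¹`, which is freely homotopic to `β⁻¹α⁻¹`, the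
inverse of `αβ`. -/
theorem LK_reverse (L : OrientedLink X 2) : L.reverse.LK = overline L.LK := by
  rw [overline, LK_eq_sum, LK_eq_sum, Finsupp.mapDomain_finsetSum]
  refine Finset.sum_bij' (fun c _ => ⟨(-c.1.1, -c.1.2), c.2⟩)
    (fun c _ => ⟨(-c.1.1, -c.1.2), by
      change L.curve 0 (- -c.1.1) = L.curve 1 (- -c.1.2)
      rw [neg_neg, neg_neg]; exact c.2⟩)
    (fun _ _ => Finset.mem_univ _) (fun _ _ => Finset.mem_univ _)
    (fun c _ => Subtype.ext (by simp)) (fun c _ => Subtype.ext (by simp)) ?_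
  rintro ⟨⟨s, t⟩, hc⟩ -
  have hc' : L.curve 0 (-s) = L.curve 1 (-t) := hc
  have hsign : L.reverse.sign (0, s) (1, t) = L.sign (0, -s) (1, -t) :=
    sign_congr ⟨fun h => L.dots_opposite _ _ _ _ h, fun h => L.dots_opposite _ _ _ _ h⟩
  refine Eq.trans ?_ (Finsupp.mapDomain_single (f := FreeLoopClass.inv)
    (a := FreeLoopClass.ofPath (L.smoothing ⟨(-s, -t), hc'⟩))
    (b := L.crossingSign ⟨(-s, -t), hc'⟩)).symm
  refine congrArg₂ Finsupp.single ?_ hsign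
  let α := loopFrom (L.curve 0) (-s)
  let β := (loopFrom (L.curve 1) (-t)).cast hc' hc'
  have hsymm : (FreeLoopClass.ofPath (α.trans β)).inv =
      FreeLoopClass.ofPath (α.symm.trans β.symm) := by
    rw [FreeLoopClass.inv_ofPath, Path.trans_symm, FreeLoopClass.ofPath_trans_comm]
  refine Eq.trans ?_ hsymm.symm
  refine FreeLoopClass.ofPath_congr fun r => ?_
  change Path.trans _ _ r = _
  rw [Path.trans_apply, Path.trans_apply]
  split_ifs
  · exact loopFrom_comp_circleNeg (L.curve 0) s _
  · exact loopFrom_comp_circleNeg (L.curve 1) t _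

end OrientedLink

end

theorem mainTheorem4 {X : Type*} [TopologicalSpace X] [ConnectedSpace X] (hX : IsTwoComplex X) :
    (∀ L L' : OrientedLink X 2, L.Isotopic L' → L.LK = L'.LK) ∧
    (∀ L : OrientedLink X 2, augmentation X L.LK = L.lk) ∧
    (∀ L : OrientedLink X 2, L.mirror.LK = -L.LK) ∧
    (∀ L : OrientedLink X 2, L.reverse.LK = overline L.LK) :=
  ⟨fun _ _ h => OrientedLink.LK_eq_of_isotopic h, OrientedLink.augmentation_LK,
    OrientedLink.LK_mirror, OrientedLink.LK_reverse⟩
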